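/- A polynomial $F\in\mathbb{C}[x,y,z,t]$ is called Cartesian if $F=G(x,y)F_1+H(z,t)F_2$ for some non-constant $G\in\mathbb{C}[x,y]$, $H\in\mathbb{C}[z,t]$ and some $F_1,F_2\in\mathbb{C}[x,y,z,t]$. Let $D(d)=\max\{(d+1)d^2,27\}$. Then the following hold. (1) Let $F\neq 0$ have degree $d$. Then $F$ is Cartesian if and only if there are irreducible polynomials $G\in\mathbb{C}[x,y]$, $H\in\mathbb{C}[z,t]$ with $1\le\deg G,\deg H\le d$ and polynomials $q,q_1,q_2\in\mathbb{C}[x,y,z,t,u]$ with $$q(1-uF)+q_1G+q_2H=1,\qquad \deg(q(1-uF)),\ \deg(q_1G),\ \deg(q_2H)\le D(d).$$ If $d=2$ and $F$ is Cartesian, then these polynomials can be chosen so that the three products have degree at most $24$. (2) Let $F\neq 0$ have degree $d$. Let $S_F$ be the following finite system of polynomial equations. Its unknowns are the coefficients $a_e$ of $G\in\mathbb{C}[x,y]$ and $b_e$ of $H\in\mathbb{C}[z,t]$ (both of degree at most $d$), the coefficients of $q,q_1,q_2\in\mathbb{C}[x,y,z,t,u]$ (of degree at most $D(d)$), and auxiliary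 unknowns $v_e,w_e$. Its equations are those obtained by comparing coefficients in $q(1-uF)+q_1G+q_2H=1$, together with $\sum_{e\ne0}v_ea_e=1$ and $\sum_{e\neq 0}w_eb_e=1$ (so $G$ and $H$ are not constant). All equations have degree at most $2$, and $F$ is Cartesian if and only if $S_F$ has a solution over $\mathbb{C}$. Moreover, for every monomial order, the ideal generated by the equations (each written in the form $p=0$) has a finite Gröbner basis, and $F$ is Cartesian if and only if any given finite Gröbner basis of this ideal contains no nonzero constant. (3) Being Cartesian is decidable, uniformly in the degree: there is a computable function that assigns to every $d\in\mathbb{N}$ a finite Boolean combination $\Phi_d$ of polynomial equations with integer coefficients in the coefficients of a polynomial, such that every $F\in\mathbb{C}[x,y,z,t]$ of degree at most $d$ is Cartesian if and only if its coefficients satisfy $\Phi_d$. -/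

import Mathlib

open MvPolynomial

noncomputable section

namespace CartesianPoly

/-! Coordinates: the variables `x, y, z, t` of `ℂ[x,y,z,t]` are `X 0, X 1, X 2, X 3` in
`MvPolynomial (Fin 4) ℂ`; the ring `ℂ[x,y,z,t,u]` is `MvPolynomial (Fin 5) ℂ` with `u = X 4`.
A polynomial in two variables is a polynomial in `x, y` through `rename ![0, 1]` and a polynomial
in `z, t` through `rename ![2, 3]`. -/

/-- `F(x,y,z,t)` is Cartesian: `F = G(x,y) F₁ + H(z,t) F₂` with `G`, `H` non-constant. -/
def IsCartesian (F : MvPolynomial (Fin 4) ℂ) : Prop :=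
  ∃ G H : MvPolynomial (Fin 2) ℂ, (∀ c : ℂ, G ≠ C c) ∧ (∀ c : ℂ, H ≠ C c) ∧
    ∃ F₁ F₂ : MvPolynomial (Fin 4) ℂ,
      F = rename (![0, 1] : Fin 2 → Fin 4) G * F₁ + rename (![2, 3] : Fin 2 → Fin 4) H * F₂

section Pieces

variable {R : Type*} [CommRing R]

/-- The polynomial `1 - u F(x,y,z,t)` of `R[x,y,z,t,u]`. -/
def rab (F : MvPolynomial (Fin 4) R) : MvPolynomial (Fin 5) R :=
  1 - X 4 * rename Fin.castSucc F

/-- `G(x,y)` as an element of `R[x,y,z,t,u]`. -/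
def inXY (G : MvPolynomial (Fin 2) R) : MvPolynomial (Fin 5) R :=
  rename (![0, 1] : Fin 2 → Fin 5) G

/-- `H(z,t)` as an element of `R[x,y,z,t,u]`. -/
def inZT (H : MvPolynomial (Fin 2) R) : MvPolynomial (Fin 5) R :=
  rename (![2, 3] : Fin 2 → Fin 5) H

end Pieces

/-- The degree bound `max {(d+1) d², 27}`. -/
def bound (d : ℕ) : ℕ := max ((d + 1) * d ^ 2) 27

/-- `G`, `H`, `q`, `q₁`, `q₂` certify that `F` is Cartesian, with degree bounds `d` for `G`, `H`
and `N` for the three products. -/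
structure IsCertificate (d N : ℕ) (F : MvPolynomial (Fin 4) ℂ) (G H : MvPolynomial (Fin 2) ℂ)
    (q q₁ q₂ : MvPolynomial (Fin 5) ℂ) : Prop where
  irreducible_G : Irreducible G
  irreducible_H : Irreducible H
  identity : q * rab F + q₁ * inXY G + q₂ * inZT H = 1
  one_le_degree_G : 1 ≤ G.totalDegree
  degree_G_le : G.totalDegree ≤ d
  one_le_degree_H : 1 ≤ H.totalDegree
  degree_H_le : H.totalDegree ≤ d
  degree_le : (q * rab F).totalDegree ≤ N
  degree_le₁ : (q₁ * inXY G).totalDegree ≤ N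
  degree_le₂ : (q₂ * inZT H).totalDegree ≤ N

/-! ### The finite polynomial system -/

/-- Exponents of the monomials of degree at most `D` in `n` variables. -/
abbrev Expo (n D : ℕ) : Type := {e : Fin n → Fin (D + 1) // ∑ i, (e i : ℕ) ≤ D}

/-- An exponent as a finitely supported function. -/
def Expo.toFinsupp {n D : ℕ} (e : Expo n D) : Fin n →₀ ℕ :=
  Finsupp.equivFunOnFinite.symm fun i => (e.1 i : ℕ)

/-- The finitely many unknowns. `inl (0, e)` and `inl (1, e)` are the coefficients of `G` and `H`
(degree `≤ d`), `inl (2, e)` and `inl (3, e)` are the auxiliary unknowns that express that `G` and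
`H` are not constant, and `inr (0, e)`, `inr (1, e)`, `inr (2, e)` are the coefficients of
`q`, `q₁`, `q₂` (degree `≤ N`). -/
abbrev Unknown (d N : ℕ) : Type := (Fin 4 × Expo 2 d) ⊕ (Fin 3 × Expo 5 N)

/-- The polynomial in two variables of degree `≤ d` whose coefficients are the unknowns of
block `k` (`k = 0` for `G`, `k = 1` for `H`). -/
def generic₂ (d N : ℕ) (k : Fin 4) : MvPolynomial (Fin 2) (MvPolynomial (Unknown d N) ℂ) :=
  ∑ e : Expo 2 d, monomial e.toFinsupp (X (Sum.inl (k, e)))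

/-- The polynomial in `x, y, z, t, u` of degree `≤ N` whose coefficients are the unknowns of
block `k` (`k = 0, 1, 2` for `q, q₁, q₂`). -/
def generic₅ (d N : ℕ) (k : Fin 3) : MvPolynomial (Fin 5) (MvPolynomial (Unknown d N) ℂ) :=
  ∑ e : Expo 5 N, monomial e.toFinsupp (X (Sum.inr (k, e)))

/-- `q (1 - u F) + q₁ G + q₂ H - 1` with unknown `G`, `H`, `q`, `q₁`, `q₂`. -/
def genericIdentity (d N : ℕ) (F : MvPolynomial (Fin 4) ℂ) :
    MvPolynomial (Fin 5) (MvPolynomial (Unknown d N) ℂ) :=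
  generic₅ d N 0 * rab (map C F) + generic₅ d N 1 * inXY (generic₂ d N 0)
    + generic₅ d N 2 * inZT (generic₂ d N 1) - 1

open Classical in
/-- The equation `∑ w_e a_e = 1`, summed over the non-constant monomials, where `a_e` are the
unknowns of block `k` and `w_e` those of block `l`: for given `a`, it is solvable in `w` if and
only if some `a_e` with `e ≠ 0` is nonzero. -/
def nonconstEq (d N : ℕ) (k l : Fin 4) : MvPolynomial (Unknown d N) ℂ :=
  ∑ e : Expo 2 d with e.toFinsupp ≠ 0, X (Sum.inl (l, e)) * X (Sum.inl (k, e)) - 1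

open Classical in
/-- The polynomial system attached to `F`: all coefficients (with respect to `x, y, z, t, u`) of
`q (1 - u F) + q₁ G + q₂ H - 1`, together with the two equations that express that `G` and `H`
are not constant. Its constants are integers and coefficients of `F`. -/
def system (d N : ℕ) (F : MvPolynomial (Fin 4) ℂ) : Finset (MvPolynomial (Unknown d N) ℂ) :=
  (genericIdentity d N F).coeffs ∪ {nonconstEq d N 0 2, nonconstEq d N 1 3}

/-! ### Gröbner bases and decision procedures -/

/-- `B` is a Gröbner basis of the ideal `I` for the monomial order `m`: it is a finite subset of
`I` whose leading terms generate the ideal of leading terms of `I`. -/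
def IsGroebnerBasis {σ : Type*} (m : MonomialOrder σ) (I : Ideal (MvPolynomial σ ℂ))
    (B : Finset (MvPolynomial σ ℂ)) : Prop :=
  (∀ b ∈ B, b ∈ I) ∧
    Ideal.span (m.leadingTerm '' (I : Set (MvPolynomial σ ℂ))) =
      Ideal.span (m.leadingTerm '' (B : Set (MvPolynomial σ ℂ)))

/-- Exponent vectors of monomials in `x, y, z, t`; each stands for the coefficient of that
monomial in an input polynomial. -/
abbrev Mono : Type := ℕ × ℕ × ℕ × ℕ

/-- The coefficient of `x^i y^j z^k t^l` in `F`. -/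
def coeffAt (F : MvPolynomial (Fin 4) ℂ) (e : Mono) : ℂ :=
  F.coeff (Finsupp.equivFunOnFinite.symm ![e.1, e.2.1, e.2.2.1, e.2.2.2])

/-- An integer polynomial in the coefficients of the input polynomial, written as a list of
terms: an integer and a list of variables to be multiplied. -/
abbrev CoeffPoly : Type := List (ℤ × List Mono)

/-- The value of a polynomial expression at the coefficients of `F`. -/
def CoeffPoly.eval (p : CoeffPoly) (F : MvPolynomial (Fin 4) ℂ) : ℂ :=
  (p.map fun s => (s.1 : ℂ) * (s.2.map (coeffAt F)).prod).sum

/-- A finite Boolean combination of polynomial equations with integer coefficients, in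
disjunctive normal form. A literal `(p, true)` means `p = 0`, a literal `(p, false)` means
`p ≠ 0`. -/
abbrev ZeroTests : Type := List (List (CoeffPoly × Bool))

/-- `F` passes the tests: for some member of the list, all the equations and inequations hold
at the coefficients of `F`. -/
def ZeroTests.Accepts (φ : ZeroTests) (F : MvPolynomial (Fin 4) ℂ) : Prop :=
  ∃ cell ∈ φ, ∀ s ∈ cell, (s.2 = true ↔ CoeffPoly.eval s.1 F = 0)

end CartesianPoly

end

/-! Certificates. Let `F ≠ 0` be Cartesian, and replace the two given polynomials by irreducible
factors `G(x,y)` and `H(z,t)`. Divide `F` by `G` and the cofactor of `H` by `G` in the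
degree-lexicographic order. Since `G` and `H` share no variables, multiplication by `H` preserves
being a remainder modulo `G`, so the two remainders match and `F = G F₁ + H F₂` holds with both
products of degree at most `deg F` (`exists_combination_totalDegree_le`). Then `1 (1 - u F) + (u F₁)
G + (u F₂) H = 1` is a certificate of degree at most `deg F + 1`, well below the required bounds.

Conversely, the identity forces `F` to vanish on the common zeros of `G` and `H` (Rabinowitsch's
trick, `isCartesian_of_identity`). Pass to irreducible factors `A`, `B`, divide `F` by `A` and the
remainder by `B`. Freezing the variables foreign to the divisor keeps a remainder a remainder, while
the Nullstellensatz in two variables makes the divisor divide it; hence the last remainder is zero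
and `F` lies in the ideal of `A` and `B` (`isCartesian_of_vanishing`).

System. Its solutions are the coefficient vectors of such identities with non-constant `G`, `H`. By
the Nullstellensatz it is solvable iff the ideal is proper, and a Gröbner basis of the unit ideal
must contain a nonzero constant (`IsGroebnerBasis.eq_top_iff`).

Decidability. The degree bounds turn being Cartesian into an existential formula in finitely many
unknown coefficients, and quantifiers are eliminated one at a time. The conditions `p = 0` for `p ∈
S` and `q ≠ 0` have a solution in one variable iff a fixed power of `q` lies outside the span of
boundedly many shifts `X ^ j * p` (`Polynomial.exists_common_root_iff`). Non-membership in a span is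
decided by division-free Gaussian elimination, branching on which coefficients vanish
(`holds_spanCells`). Everything acts on lists of signed monomials and is primitive recursive. -/

/-! ### Quantifier elimination over an algebraically closed field -/

/-- An integer polynomial as a list of signed monomials; `true` is the sign `+`. -/
abbrev SignedPoly (V : Type*) : Type _ := List (Bool × List V)

namespace SignedPoly

variable {V : Type*} {A : Type*} [CommRing A]

def eval (ρ : V → A) (p : SignedPoly V) : A :=
  (p.map fun s => (bif s.1 then 1 else -1) * (s.2.map ρ).prod).sum

def mul (p q : SignedPoly V) : SignedPoly V :=
  p.flatMap fun s => q.map fun t => (s.1 == t.1, s.2 ++ t.2)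

def neg (p : SignedPoly V) : SignedPoly V := p.map fun s => (!s.1, s.2)

def pow (p : SignedPoly V) (n : ℕ) : SignedPoly V := (mul p)^[n] [(true, [])]

/-- An upper bound for the degree in each variable. -/
def weight (p : SignedPoly V) : ℕ := (p.flatMap Prod.snd).length

@[simp] lemma eval_nil (ρ : V → A) : eval ρ [] = 0 := rfl

@[simp] lemma eval_cons (ρ : V → A) (s : Bool × List V) (p : SignedPoly V) :
    eval ρ (s :: p) = (bif s.1 then 1 else -1) * (s.2.map ρ).prod + eval ρ p := by
  simp [eval]

@[simp] lemma eval_append (ρ : V → A) (p q : SignedPoly V) :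
    eval ρ (p ++ q) = eval ρ p + eval ρ q := by
  simp [eval]

lemma eval_flatMap {β : Type*} (ρ : V → A) (l : List β) (f : β → SignedPoly V) :
    eval ρ (l.flatMap f) = (l.map fun b => eval ρ (f b)).sum := by
  induction l with
  | nil => rfl
  | cons b l ih => simp [ih]

@[simp] lemma eval_neg (ρ : V → A) (p : SignedPoly V) : eval ρ (neg p) = -eval ρ p := by
  induction p with
  | nil => simp [neg]
  | cons s p ih =>
    have : neg (s :: p) = (!s.1, s.2) :: neg p := rfl
    rw [this, eval_cons, ih, eval_cons]
    cases s.1 <;> simp [add_comm]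

@[simp] lemma eval_mul (ρ : V → A) (p q : SignedPoly V) :
    eval ρ (mul p q) = eval ρ p * eval ρ q := by
  induction p with
  | nil => simp [mul]
  | cons s p ih =>
    have h : mul (s :: p) q = (q.map fun t => (s.1 == t.1, s.2 ++ t.2)) ++ mul p q := rfl
    rw [h, eval_append, ih, eval_cons, add_mul]
    congr 1
    clear ih h
    induction q with
    | nil => simp
    | cons t q ih =>
      rw [List.map_cons, eval_cons, ih, eval_cons, mul_add]
      congr 1
      cases s.1 <;> cases t.1 <;> simp

@[simp] lemma eval_pow (ρ : V → A) (p : SignedPoly V) (n : ℕ) :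
    eval ρ (pow p n) = eval ρ p ^ n := by
  induction n with
  | zero => simp [pow]
  | succ n ih =>
    have : pow p (n + 1) = mul p (pow p n) := Function.iterate_succ_apply' _ _ _
    rw [this, eval_mul, ih, pow_succ']

lemma map_eval {B : Type*} [CommRing B] (f : A →+* B) (ρ : V → A) (p : SignedPoly V) :
    f (eval ρ p) = eval (fun y => f (ρ y)) p := by
  induction p with
  | nil => simp
  | cons s p ih =>
    rw [eval_cons, eval_cons, map_add, ih, map_mul, map_list_prod, List.map_map]
    cases s.1 <;> simp [Function.comp_def]

/-! ### Polynomials in many variables seen as polynomials in one of them -/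

section Univariate

variable [DecidableEq V] (x : V)

def without (l : List V) : List V := l.flatMap fun y => if y = x then [] else [y]

def mult (l : List V) : ℕ := l.length - (without x l).length

/-- The coefficient of the `i`-th power of the variable `x`. -/
def coeff (i : ℕ) (p : SignedPoly V) : SignedPoly V :=
  p.flatMap fun s => if mult x s.2 = i then [(s.1, without x s.2)] else []

/-- The univariate polynomial in the variable `x` obtained by evaluating the other variables. -/
noncomputable def uni (ρ : V → A) (p : SignedPoly V) : Polynomial A :=
  eval (fun y => if y = x then Polynomial.X else Polynomial.C (ρ y)) p

lemma length_without_le (l : List V) : (without x l).length ≤ l.length := by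
  induction l with
  | nil => simp [without]
  | cons y l ih =>
    have h : without x (y :: l) = (if y = x then [] else [y]) ++ without x l := rfl
    rw [h]
    split_ifs <;> simp <;> omega

lemma prod_eq_without (ρ : V → A) (l : List V) :
    (l.map fun y => if y = x then Polynomial.X else Polynomial.C (ρ y)).prod =
      Polynomial.C ((without x l).map ρ).prod * Polynomial.X ^ mult x l := by
  induction l with
  | nil => simp [without, mult]
  | cons y l ih =>
    have h : without x (y :: l) = (if y = x then [] else [y]) ++ without x l := rfl
    have hl := length_without_le x l
    by_cases hy : y = x
    · have h1 : mult x (y :: l) = mult x l + 1 := by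
        simp only [mult, h, if_pos hy, List.nil_append, List.length_cons]; omega
      rw [List.map_cons, List.prod_cons, ih, h1, h]
      simp only [if_pos hy, List.nil_append]
      ring
    · have h1 : mult x (y :: l) = mult x l := by
        simp only [mult, h, if_neg hy, List.length_cons, List.length_append, List.length_nil]; omega
      rw [List.map_cons, List.prod_cons, ih, h1, h]
      simp only [if_neg hy, List.cons_append, List.nil_append, List.map_cons, List.prod_cons,
        map_mul]
      ring

/-- The extraction of coefficients on lists does not depend on `ρ`. This is what makes the
elimination uniform in the parameters. -/
lemma coeff_uni (ρ : V → A) (p : SignedPoly V) (i : ℕ) :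
    (uni x ρ p).coeff i = eval ρ (coeff x i p) := by
  induction p with
  | nil => simp [uni, coeff]
  | cons s p ih =>
    have h : coeff x i (s :: p) =
      (if mult x s.2 = i then [(s.1, without x s.2)] else []) ++ coeff x i p := rfl
    have h' : (bif s.1 then 1 else -1 : Polynomial A) = Polynomial.C (bif s.1 then 1 else -1) := by
      cases s.1 <;> simp
    rw [h, eval_append, ← ih, uni, eval_cons, Polynomial.coeff_add, prod_eq_without, ← mul_assoc,
      h', ← Polynomial.C_mul, Polynomial.coeff_C_mul_X_pow]
    congr 1
    by_cases hi : mult x s.2 = i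
    · simp [hi]
    · simp [hi, Ne.symm hi]

lemma natDegree_uni_le (ρ : V → A) (p : SignedPoly V) : (uni x ρ p).natDegree ≤ weight p := by
  induction p with
  | nil => simp [uni]
  | cons s p ih =>
    have h : weight (s :: p) = s.2.length + weight p := by simp [weight]
    have h' : (bif s.1 then 1 else -1 : Polynomial A) = Polynomial.C (bif s.1 then 1 else -1) := by
      cases s.1 <;> simp
    rw [h, uni, eval_cons, prod_eq_without, ← mul_assoc, h', ← Polynomial.C_mul]
    refine (Polynomial.natDegree_add_le _ _).trans (max_le ?_ (ih.trans (by omega)))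
    refine (Polynomial.natDegree_C_mul_X_pow_le _ _).trans ?_
    have : mult x s.2 ≤ s.2.length := Nat.sub_le _ _
    omega

lemma eval_uni (ρ : V → A) (p : SignedPoly V) (a : A) :
    (uni x ρ p).eval a = eval (Function.update ρ x a) p := by
  rw [uni, ← Polynomial.coe_evalRingHom, map_eval]
  congr 1
  funext y
  by_cases hy : y = x
  · subst hy; simp
  · simp [hy]

end Univariate

/-- A conjunction of equations `(p, true)` and inequations `(p, false)`. -/
abbrev Cell (V : Type*) : Type _ := List (SignedPoly V × Bool)

def Cell.Holds (c : Cell V) (ρ : V → A) : Prop := ∀ s ∈ c, (s.2 = true ↔ eval ρ s.1 = 0)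

def Cell.weight (c : Cell V) : ℕ := (c.flatMap fun s => s.1.flatMap Prod.snd).length

def Cell.equations (c : Cell V) : List (SignedPoly V) :=
  c.flatMap fun s => bif s.2 then [s.1] else []

/-- Over a domain, finitely many inequations amount to the single one for their product. -/
def Cell.inequation (c : Cell V) : SignedPoly V :=
  c.foldr (fun s q => bif s.2 then q else mul s.1 q) [(true, [])]

@[simp] lemma Cell.holds_append (c c' : Cell V) (ρ : V → A) :
    Cell.Holds (c ++ c') ρ ↔ Cell.Holds c ρ ∧ Cell.Holds c' ρ := by
  simp only [Cell.Holds, List.mem_append, or_imp, forall_and]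

lemma Cell.mem_equations (c : Cell V) (p : SignedPoly V) :
    p ∈ Cell.equations c ↔ (p, true) ∈ c := by
  simp only [equations, List.mem_flatMap]
  constructor
  · rintro ⟨⟨q, b⟩, hs, hp⟩
    cases b <;> simp at hp
    subst hp; exact hs
  · intro h
    exact ⟨_, h, by simp⟩

lemma Cell.eval_inequation_ne_zero [IsDomain A] (c : Cell V) (ρ : V → A) :
    eval ρ (Cell.inequation c) ≠ 0 ↔ ∀ p, (p, false) ∈ c → eval ρ p ≠ 0 := by
  induction c with
  | nil => simp [inequation]
  | cons s c ih =>
    obtain ⟨p, b⟩ := s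
    have h : inequation ((p, b) :: c) =
      bif b then inequation c else mul p (inequation c) := rfl
    cases b
    · rw [h, cond_false, eval_mul, mul_ne_zero_iff, ih]
      simp [or_imp, forall_and]
    · rw [h, cond_true, ih]
      simp

lemma Cell.holds_iff [IsDomain A] (c : Cell V) (ρ : V → A) :
    Cell.Holds c ρ ↔ (∀ p ∈ Cell.equations c, eval ρ p = 0) ∧
      eval ρ (Cell.inequation c) ≠ 0 := by
  simp only [eval_inequation_ne_zero, mem_equations, Cell.Holds, Prod.forall, Bool.forall_bool]
  simp [forall_and, and_comm]

lemma Cell.weight_cons (s : SignedPoly V × Bool) (c : Cell V) :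
    Cell.weight (s :: c) = SignedPoly.weight s.1 + Cell.weight c := by
  simp [weight, SignedPoly.weight]

lemma Cell.weight_le_of_mem (c : Cell V) {s : SignedPoly V × Bool} (hs : s ∈ c) :
    SignedPoly.weight s.1 ≤ Cell.weight c := by
  induction c with
  | nil => simp at hs
  | cons t c ih =>
    rw [weight_cons]
    rcases List.mem_cons.mp hs with rfl | h
    · omega
    · have := ih h; omega

lemma Cell.natDegree_uni_inequation_le [DecidableEq V] (x : V) (c : Cell V) (ρ : V → A) :
    (uni x ρ (Cell.inequation c)).natDegree ≤ Cell.weight c := by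
  induction c with
  | nil => simp [inequation, uni, weight]
  | cons s c ih =>
    obtain ⟨p, b⟩ := s
    have h : inequation ((p, b) :: c) =
      bif b then inequation c else mul p (inequation c) := rfl
    rw [weight_cons]
    cases b
    · rw [h, cond_false, uni, eval_mul]
      exact Polynomial.natDegree_mul_le.trans (add_le_add (natDegree_uni_le x ρ p) ih)
    · rw [h, cond_true]
      exact ih.trans (by omega)

/-! #### Non-membership in a span by pivoting -/

section Pivot

variable [DecidableEq V] (x : V)

/-- A case of the elimination: under the conditions of the cell, decide whether a polynomial in `x`
lies outside the span of a list of polynomials in `x`. -/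
abbrev SpanCase (V : Type*) : Type _ := Cell V × SignedPoly V × List (SignedPoly V)

/-- Cross-multiplication instead of division, so that the coefficients remain integer polynomials in
the parameters. -/
def cancel (i : ℕ) (w u : SignedPoly V) : SignedPoly V :=
  mul (coeff x i w) u ++ neg (mul (coeff x i u) w)

def vanish (w : SignedPoly V) : Cell V :=
  (List.range (weight w + 1)).map fun i => (coeff x i w, true)

/-- Either the first generator vanishes and is dropped, or one of its coefficients is a nonzero
pivot. The branches for different pivots may overlap, which is harmless in a disjunction. -/
def pivot (s : SpanCase V) : List (SpanCase V) :=
  match s.2.2 with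
  | [] => [s]
  | w :: ws => (s.1 ++ vanish x w, s.2.1, ws) ::
      (List.range (weight w + 1)).map fun i =>
        (s.1 ++ [(coeff x i w, false)], cancel x i w s.2.1, ws.map (cancel x i w))

def pivots (s : SpanCase V) : List (SpanCase V) :=
  (fun l : List (SpanCase V) => l.flatMap (pivot x))^[s.2.2.length] [s]

def nonzero (s : SpanCase V) : List (Cell V) :=
  (List.range (weight s.2.1 + 1)).map fun i => s.1 ++ [(coeff x i s.2.1, false)]

def spanCells (s : SpanCase V) : List (Cell V) := (pivots x s).flatMap (nonzero x)

def SpanCase.Holds {K : Type*} [Field K] (s : SpanCase V) (ρ : V → K) : Prop :=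
  Cell.Holds s.1 ρ ∧
    uni x ρ s.2.1 ∉ Submodule.span K (uni x ρ '' {w | w ∈ s.2.2})

variable {K : Type*} [Field K]

lemma holds_vanish (w : SignedPoly V) (ρ : V → K) :
    Cell.Holds (vanish x w) ρ ↔ uni x ρ w = 0 := by
  have h : Cell.Holds (vanish x w) ρ ↔ ∀ i < weight w + 1, (uni x ρ w).coeff i = 0 := by
    simp [Cell.Holds, vanish, coeff_uni, List.mem_map]
  rw [h]
  constructor
  · intro h
    ext i
    by_cases hi : i < weight w + 1
    · simpa using h i hi
    · rw [Polynomial.coeff_eq_zero_of_natDegree_lt]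
      · simp
      · have := natDegree_uni_le x ρ w; omega
  · intro h i _
    simp [h]

lemma exists_coeff_ne_zero (w : SignedPoly V) (ρ : V → K) :
    (∃ i < weight w + 1, eval ρ (coeff x i w) ≠ 0) ↔ uni x ρ w ≠ 0 := by
  rw [Ne, ← holds_vanish]
  simp [Cell.Holds, vanish]

/-- The linear map `u ↦ f w • u - f u • w` kills `w`, and its kernel is the line through `w` because
`f w ≠ 0`. So membership modulo `w` can be tested on images. -/
lemma mem_span_insert_iff_cancel {M : Type*} [AddCommGroup M] [Module K M] (f : M →ₗ[K] K) (w v : M)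
    (S : Set M) (hw : f w ≠ 0) :
    v ∈ Submodule.span K (insert w S) ↔
      f w • v - f v • w ∈ Submodule.span K ((fun u => f w • u - f u • w) '' S) := by
  let φ : M →ₗ[K] M := f w • LinearMap.id - f.smulRight w
  have hφ : ∀ u, φ u = f w • u - f u • w := fun u => by simp [φ]
  have himg : ((fun u => f w • u - f u • w) '' S) = φ '' S := by
    ext; simp [hφ]
  rw [himg, ← hφ, Submodule.span_image, Submodule.mem_map]
  constructor
  · intro h
    obtain ⟨a, z, hz, rfl⟩ := Submodule.mem_span_insert.mp h
    refine ⟨z, hz, ?_⟩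
    rw [map_add, map_smul, hφ w, sub_self, smul_zero, zero_add]
  · rintro ⟨z, hz, h⟩
    rw [hφ, hφ] at h
    have : v = (f w)⁻¹ • (f w • z - f z • w + f v • w) := by
      rw [h, sub_add_cancel, smul_smul, inv_mul_cancel₀ hw, one_smul]
    rw [this]
    have hw' := Submodule.subset_span (R := K) (Set.mem_insert w S)
    have hz' := Submodule.span_mono (R := K) (Set.subset_insert w S) hz
    exact Submodule.smul_mem _ _ (add_mem (sub_mem (Submodule.smul_mem _ _ hz')
      (Submodule.smul_mem _ _ hw')) (Submodule.smul_mem _ _ hw'))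

/-- The variable `x` has been removed from the extracted coefficient, so it becomes a constant
polynomial. -/
lemma uni_coeff (ρ : V → K) (i : ℕ) (w : SignedPoly V) :
    uni x ρ (coeff x i w) = Polynomial.C ((uni x ρ w).coeff i) := by
  rw [coeff_uni, map_eval]
  have key : ∀ l : List V, ((without x l).map fun y =>
      if y = x then Polynomial.X else Polynomial.C (ρ y)) =
      (without x l).map fun y => Polynomial.C (ρ y) := by
    intro l
    refine List.map_congr_left fun y hy => if_neg ?_
    simp only [without, List.mem_flatMap] at hy
    obtain ⟨z, -, hz⟩ := hy
    split_ifs at hz with h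
    · simp at hz
    · rw [List.mem_singleton.mp hz]; exact h
  induction w with
  | nil => simp [uni, coeff]
  | cons s w ih =>
    have h : coeff x i (s :: w) =
      (if mult x s.2 = i then [(s.1, without x s.2)] else []) ++ coeff x i w := rfl
    rw [h, uni, eval_append, eval_append, ← ih, ← uni]
    congr 1
    split_ifs
    · simp [uni, eval, key]
    · simp [uni]

lemma uni_cancel (ρ : V → K) (i : ℕ) (w u : SignedPoly V) :
    uni x ρ (cancel x i w u) =
      (uni x ρ w).coeff i • uni x ρ u - (uni x ρ u).coeff i • uni x ρ w := by
  rw [Polynomial.smul_eq_C_mul, Polynomial.smul_eq_C_mul, ← uni_coeff, ← uni_coeff]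
  simp [uni, cancel, sub_eq_add_neg]

lemma holds_pivot (s : SpanCase V) (ρ : V → K) :
    SpanCase.Holds x s ρ ↔ ∃ t ∈ pivot x s, SpanCase.Holds x t ρ := by
  obtain ⟨c, v, _ | ⟨w, ws⟩⟩ := s
  · simp [pivot]
  · have hset : {u | u ∈ w :: ws} = insert w {u | u ∈ ws} := by ext; simp
    have hb : ∀ i, SpanCase.Holds x
        (c ++ [(coeff x i w, false)], cancel x i w v, ws.map (cancel x i w)) ρ ↔
        eval ρ (coeff x i w) ≠ 0 ∧ SpanCase.Holds x (c, v, w :: ws) ρ := by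
      intro i
      simp only [SpanCase.Holds, Cell.holds_append, hset, Set.image_insert_eq]
      have hc : Cell.Holds [(coeff x i w, false)] ρ ↔ eval ρ (coeff x i w) ≠ 0 := by
        simp [Cell.Holds]
      rw [hc]
      by_cases h0 : eval ρ (coeff x i w) = 0
      · simp [h0]
      · have him : (uni x ρ '' {u | u ∈ ws.map (cancel x i w)}) =
            (fun u => Polynomial.lcoeff K i (uni x ρ w) • u -
              Polynomial.lcoeff K i u • uni x ρ w) '' (uni x ρ '' {u | u ∈ ws}) := by
          ext z
          simp only [Set.mem_image, Set.mem_ofPred_eq, List.mem_map, exists_exists_and_eq_and,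
            uni_cancel, Polynomial.lcoeff_apply]
        rw [mem_span_insert_iff_cancel (Polynomial.lcoeff K i) (uni x ρ w) (uni x ρ v) _
          (by rw [Polynomial.lcoeff_apply, coeff_uni]; exact h0), him, uni_cancel]
        simp only [Polynomial.lcoeff_apply]
        tauto
    simp only [pivot, List.mem_cons, List.mem_map, List.mem_range, exists_eq_or_imp,
      exists_exists_and_eq_and]
    have hv : SpanCase.Holds x (c ++ vanish x w, v, ws) ρ ↔
        uni x ρ w = 0 ∧ SpanCase.Holds x (c, v, w :: ws) ρ := by
      simp only [SpanCase.Holds, Cell.holds_append, hset, Set.image_insert_eq, holds_vanish]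
      by_cases h0 : uni x ρ w = 0
      · simp [h0]
      · simp [h0]
    have := exists_coeff_ne_zero x w ρ
    rw [hv]
    constructor
    · intro h
      by_cases h0 : uni x ρ w = 0
      · exact Or.inl ⟨h0, h⟩
      · obtain ⟨i, hi, hi'⟩ := this.mpr h0
        exact Or.inr ⟨i, hi, (hb i).mpr ⟨hi', h⟩⟩
    · rintro (h | ⟨i, -, h⟩)
      · exact h.2
      · exact ((hb i).mp h).2

lemma length_of_mem_pivot (s t : SpanCase V) (h : t ∈ pivot x s) :
    t.2.2.length = s.2.2.length - 1 := by
  obtain ⟨c, v, _ | ⟨w, ws⟩⟩ := s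
  · simp only [pivot, List.mem_singleton] at h
    subst h; rfl
  · simp only [pivot, List.mem_cons, List.mem_map] at h
    rcases h with rfl | ⟨i, -, rfl⟩ <;> simp

lemma pivots_spec (s : SpanCase V) (n : ℕ) :
    (∀ t ∈ (fun l : List (SpanCase V) => l.flatMap (pivot x))^[n] [s],
      t.2.2.length = s.2.2.length - n) ∧
    ∀ ρ : V → K, SpanCase.Holds x s ρ ↔
      ∃ t ∈ (fun l : List (SpanCase V) => l.flatMap (pivot x))^[n] [s], SpanCase.Holds x t ρ := by
  induction n with
  | zero => simp
  | succ n ih =>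
    rw [Function.iterate_succ_apply']
    refine ⟨fun t ht => ?_, fun ρ => ?_⟩
    · obtain ⟨u, hu, ht⟩ := List.mem_flatMap.mp ht
      rw [length_of_mem_pivot x u t ht, ih.1 u hu]
      omega
    · rw [ih.2 ρ]
      simp only [List.mem_flatMap]
      constructor
      · rintro ⟨t, ht, h⟩
        obtain ⟨u, hu, h⟩ := (holds_pivot x t ρ).mp h
        exact ⟨u, ⟨t, ht, hu⟩, h⟩
      · rintro ⟨u, ⟨t, ht, hu⟩, h⟩
        exact ⟨t, ht, (holds_pivot x t ρ).mpr ⟨u, hu, h⟩⟩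

lemma holds_spanCells (s : SpanCase V) (ρ : V → K) :
    SpanCase.Holds x s ρ ↔ ∃ c ∈ spanCells x s, Cell.Holds c ρ := by
  obtain ⟨h1, h2⟩ := pivots_spec (K := K) x s s.2.2.length
  rw [h2 ρ, spanCells]
  simp only [List.mem_flatMap, pivots]
  -- After as many pivots as there are generators, the span is zero and the question is only whether
  -- the reduced polynomial is nonzero.
  have key : ∀ t : SpanCase V, t.2.2.length = 0 →
      (SpanCase.Holds x t ρ ↔ ∃ c ∈ nonzero x t, Cell.Holds c ρ) := by
    rintro ⟨c, v, ws⟩ ht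
    obtain rfl := List.length_eq_zero_iff.mp ht
    have := exists_coeff_ne_zero x v ρ
    simp only [SpanCase.Holds, nonzero, List.mem_map, List.mem_range, exists_exists_and_eq_and,
      Cell.holds_append]
    have hs : Submodule.span K (uni x ρ '' {w | w ∈ ([] : List (SignedPoly V))}) = ⊥ := by simp
    rw [hs, Submodule.mem_bot, ← Ne, ← this]
    simp only [Cell.Holds, List.mem_singleton, forall_eq]
    constructor
    · rintro ⟨hc, i, hi, h⟩
      exact ⟨i, hi, hc, by simpa using h⟩
    · rintro ⟨i, hi, hc, h⟩
      exact ⟨hc, i, hi, by simpa using h⟩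
  constructor
  · rintro ⟨t, ht, h⟩
    obtain ⟨c, hc, h⟩ := (key t (by rw [h1 t ht]; omega)).mp h
    exact ⟨c, ⟨t, ht, hc⟩, h⟩
  · rintro ⟨c, ⟨t, ht, hc⟩, h⟩
    exact ⟨t, ht, (key t (by rw [h1 t ht]; omega)).mpr ⟨c, hc, h⟩⟩

end Pivot

end SignedPoly

/-! ### Bounded-degree ideal membership and common roots in one variable -/

namespace Polynomial

variable {K : Type*} [Field K]

/-- The multiples `X ^ j * p` of the members of a set, with `j ≤ M`. -/
def shifts (S : Set K[X]) (M : ℕ) : Set K[X] := {r | ∃ p ∈ S, ∃ j ≤ M, r = X ^ j * p}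

lemma mul_mem_span_shifts {S : Set K[X]} {M : ℕ} {p r : K[X]} (hp : p ∈ S) (hr : r.natDegree ≤ M) :
    r * p ∈ Submodule.span K (shifts S M) := by
  rw [r.as_sum_range_C_mul_X_pow, Finset.sum_mul]
  refine Submodule.sum_mem _ fun j hj => ?_
  rw [mul_assoc, ← smul_eq_C_mul]
  refine Submodule.smul_mem _ _ (Submodule.subset_span ⟨p, hp, j, ?_, rfl⟩)
  have := Finset.mem_range.mp hj
  omega

lemma natDegree_le_of_mem_span_shifts {S : Set K[X]} {M L : ℕ} (hS : ∀ p ∈ S, p.natDegree ≤ L)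
    {r : K[X]} (hr : r ∈ Submodule.span K (shifts S M)) : r.natDegree ≤ M + L := by
  have : Submodule.span K (shifts S M) ≤ degreeLE K (M + L : ℕ) := by
    rw [Submodule.span_le]
    rintro _ ⟨p, hp, j, hj, rfl⟩
    rw [SetLike.mem_coe, mem_degreeLE]
    refine natDegree_le_iff_degree_le.mp (natDegree_mul_le.trans (add_le_add ?_ (hS p hp)))
    simpa using hj
  exact natDegree_le_iff_degree_le.mpr (mem_degreeLE.mp (this hr))

/-- Fix a nonzero `p ∈ S` and reduce the cofactors of all generators modulo `p`. The reduced part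
has degree at most `2 * L ≤ M`, so the remaining multiple `c * p` has degree at most `M`, and hence
so does `c`. -/
lemma mem_span_shifts {S : Set K[X]} {L M : ℕ} (hS : ∀ p ∈ S, p.natDegree ≤ L) (hM : 2 * L ≤ M)
    {f : K[X]} (hf : f ∈ Ideal.span S) (hfM : f.natDegree ≤ M) :
    f ∈ Submodule.span K (shifts S M) := by
  by_cases h0 : ∀ p ∈ S, p = 0
  · rw [Ideal.span_eq_bot.mpr h0] at hf
    rw [Submodule.mem_bot _ |>.mp hf]
    exact zero_mem _
  push Not at h0
  obtain ⟨p, hp, hp0⟩ := h0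
  -- The arbitrary multiplier `a` lets the induction pass through multiplication by ring elements.
  have key : ∀ a, ∃ g ∈ Submodule.span K (shifts S L), ∃ c, a * f = g + c * p := by
    clear hfM
    induction hf using Submodule.span_induction with
    | mem q hq =>
      refine fun a => ⟨a % p * q, mul_mem_span_shifts hq ?_, a / p * q, ?_⟩
      · exact (natDegree_le_natDegree (degree_mod_lt a hp0).le).trans (hS p hp)
      · linear_combination (-q) * EuclideanDomain.mod_add_div a p
    | zero => exact fun a => ⟨0, zero_mem _, 0, by simp⟩
    | add b b' _ _ ih ih' =>
      intro a
      obtain ⟨g, hg, c, hc⟩ := ih a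
      obtain ⟨g', hg', c', hc'⟩ := ih' a
      exact ⟨g + g', add_mem hg hg', c + c', by rw [mul_add, hc, hc']; ring⟩
    | smul r b _ ih =>
      intro a
      obtain ⟨g, hg, c, hc⟩ := ih (a * r)
      exact ⟨g, hg, c, by rw [← hc, smul_eq_mul, mul_assoc]⟩
  obtain ⟨g, hg, c, hc⟩ := key 1
  rw [one_mul] at hc
  have hg' := natDegree_le_of_mem_span_shifts hS hg
  have hgM : g ∈ Submodule.span K (shifts S M) := by
    refine Submodule.span_mono ?_ hg
    rintro _ ⟨p, hp, j, hj, rfl⟩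
    exact ⟨p, hp, j, by omega, rfl⟩
  have hcM : c.natDegree ≤ M := by
    by_cases hc0 : c = 0
    · simp [hc0]
    have h1 : c * p = f - g := by rw [hc]; ring
    have h2 : (c * p).natDegree ≤ M := by
      rw [h1]
      exact (natDegree_sub_le _ _).trans (max_le hfM (by omega))
    rw [natDegree_mul hc0 hp0] at h2
    omega
  rw [hc]
  exact add_mem hgM (mul_mem_span_shifts hp hcM)

/-- Each root of `g` has multiplicity at most `g.natDegree ≤ n`, and multiplicity at least `n` in `q
^ n`. -/
lemma dvd_pow_of_roots [IsAlgClosed K] {g q : K[X]} (hg : g ≠ 0)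
    (h : ∀ a, g.eval a = 0 → q.eval a = 0) {n : ℕ} (hn : g.natDegree ≤ n) : g ∣ q ^ n := by
  classical
  by_cases hq : q ^ n = 0
  · simp [hq]
  rw [IsAlgClosed.dvd_iff_roots_le_roots hg hq, Multiset.le_iff_count]
  intro a
  rw [roots_pow, Multiset.count_nsmul]
  by_cases ha : g.eval a = 0
  · by_cases hn0 : n = 0
    · subst hn0
      rw [eq_C_of_natDegree_eq_zero (Nat.le_zero.mp hn)]
      simp
    have hq0 : q ≠ 0 := fun h0 => hq (by rw [h0, zero_pow hn0])
    have h1 : 1 ≤ q.roots.count a := by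
      rw [Nat.one_le_iff_ne_zero, Ne, Multiset.count_eq_zero, not_not, mem_roots hq0]
      exact h a ha
    have h2 : g.roots.count a ≤ g.natDegree := (Multiset.count_le_card _ _).trans (card_roots' g)
    calc g.roots.count a ≤ n * 1 := by omega
      _ ≤ n * q.roots.count a := Nat.mul_le_mul_left n h1
  · rw [Multiset.count_eq_zero_of_notMem]
    · exact Nat.zero_le _
    · rw [mem_roots hg]; exact ha

/-- Evaluation at a common root `a` kills the span but not the power of `q`. Without such a root,
every zero of the generator `g` of the ideal is a zero of `q`, so `g` divides the power. The
exponent is `L + 1` rather than `L` so that it is positive, which matters when `q = 0`. -/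
lemma exists_common_root_iff [IsAlgClosed K] {S : Set K[X]} {q : K[X]} {L : ℕ}
    (hS : ∀ p ∈ S, p.natDegree ≤ L) (hq : q.natDegree ≤ L) :
    (∃ a, (∀ p ∈ S, p.eval a = 0) ∧ q.eval a ≠ 0) ↔
      q ^ (L + 1) ∉ Submodule.span K (shifts S ((L + 1) * L + 2 * L)) := by
  constructor
  · rintro ⟨a, ha, hqa⟩ hmem
    have : Submodule.span K (shifts S ((L + 1) * L + 2 * L)) ≤ LinearMap.ker (leval a) := by
      rw [Submodule.span_le]
      rintro _ ⟨p, hp, j, -, rfl⟩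
      simp [leval, ha p hp]
    have := this hmem
    simp only [LinearMap.mem_ker, leval_apply, eval_pow] at this
    exact hqa (pow_eq_zero_iff (by omega) |>.mp this)
  · intro hmem
    by_contra! hcon
    refine hmem (mem_span_shifts hS (by omega) ?_ ?_)
    · obtain ⟨g, hg⟩ := (IsPrincipalIdealRing.principal (Ideal.span S)).principal
      have hdvd : ∀ f, f ∈ Ideal.span S ↔ g ∣ f := fun f => by
        rw [hg]; exact Ideal.mem_span_singleton
      rw [hdvd]
      have hroot : ∀ a, g.eval a = 0 → q.eval a = 0 := fun a ha => hcon a fun p hp =>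
        eval_eq_zero_of_dvd_of_eval_eq_zero ((hdvd p).mp (Ideal.subset_span hp)) ha
      by_cases hg0 : g = 0
      · have : q = 0 := Polynomial.funext fun a => by simpa using hroot a (by simp [hg0])
        simp [this]
      · refine dvd_pow_of_roots hg0 hroot ?_
        have : ∃ p ∈ S, p ≠ 0 := by
          by_contra! h0
          rw [Ideal.span_eq_bot.mpr h0] at hg
          exact hg0 (Ideal.span_singleton_eq_bot.mp hg.symm)
        obtain ⟨p, hp, hp0⟩ := this
        have := natDegree_le_of_dvd ((hdvd p).mp (Ideal.subset_span hp)) hp0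
        have := hS p hp
        omega
    · refine natDegree_pow_le.trans ?_
      have := Nat.mul_le_mul_left (L + 1) hq
      omega

end Polynomial

/-! ### Elimination of one variable, then of a list of variables -/

namespace SignedPoly

variable {V : Type*} [DecidableEq V]

/-- `x ^ j * p` -/
def shift (x : V) (j : ℕ) (p : SignedPoly V) : SignedPoly V :=
  mul [(true, (List.range j).map fun _ => x)] p

/-- The constants are those of `Polynomial.exists_common_root_iff` with `L` the weight of the cell,
a degree bound valid for every value of the parameters. -/
def spanCase (x : V) (c : Cell V) : SpanCase V :=
  ([], pow (Cell.inequation c) (Cell.weight c + 1),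
    (Cell.equations c).flatMap fun p =>
      (List.range ((Cell.weight c + 1) * Cell.weight c + 2 * Cell.weight c + 1)).map fun j =>
        shift x j p)

/-- The elimination of a variable from a disjunction of cells. -/
def eliminate (x : V) (φ : List (Cell V)) : List (Cell V) :=
  φ.flatMap fun c => spanCells x (spanCase x c)

variable {K : Type*} [Field K]

def Holds (φ : List (Cell V)) (ρ : V → K) : Prop := ∃ c ∈ φ, Cell.Holds c ρ

lemma uni_shift (x : V) (ρ : V → K) (j : ℕ) (p : SignedPoly V) :
    uni x ρ (shift x j p) = Polynomial.X ^ j * uni x ρ p := by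
  rw [uni, shift, eval_mul, ← uni]
  congr 1
  simp [uni, eval, List.map_const']

lemma holds_spanCase [IsAlgClosed K] (x : V) (c : Cell V) (ρ : V → K) :
    SpanCase.Holds x (spanCase x c) ρ ↔ ∃ a, Cell.Holds c (Function.update ρ x a) := by
  have h := Polynomial.exists_common_root_iff (S := uni x ρ '' {p | p ∈ Cell.equations c})
    (q := uni x ρ (Cell.inequation c)) (L := Cell.weight c) ?_
    (Cell.natDegree_uni_inequation_le x c ρ)
  · simp only [Cell.holds_iff, ← eval_uni]
    rw [SpanCase.Holds, spanCase]
    have h1 : uni x ρ (pow (Cell.inequation c) (Cell.weight c + 1)) =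
        uni x ρ (Cell.inequation c) ^ (Cell.weight c + 1) := eval_pow _ _ _
    have h2 : (uni x ρ '' {w | w ∈ (Cell.equations c).flatMap fun p =>
        (List.range ((Cell.weight c + 1) * Cell.weight c + 2 * Cell.weight c + 1)).map fun j =>
          shift x j p}) = Polynomial.shifts (uni x ρ '' {p | p ∈ Cell.equations c})
        ((Cell.weight c + 1) * Cell.weight c + 2 * Cell.weight c) := by
      ext r
      simp only [Polynomial.shifts, Set.mem_image, Set.mem_ofPred_eq, List.mem_flatMap, List.mem_map,
        List.mem_range, Nat.lt_succ_iff]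
      constructor
      · rintro ⟨_, ⟨p, hp, j, hj, rfl⟩, rfl⟩
        exact ⟨_, ⟨p, hp, rfl⟩, j, hj, uni_shift x ρ j p⟩
      · rintro ⟨_, ⟨p, hp, rfl⟩, j, hj, rfl⟩
        exact ⟨_, ⟨p, hp, j, hj, rfl⟩, uni_shift x ρ j p⟩
    rw [h1, h2, ← h]
    simp [Cell.Holds]
  · rintro _ ⟨p, hp, rfl⟩
    exact (natDegree_uni_le x ρ p).trans
      (Cell.weight_le_of_mem c ((Cell.mem_equations c p).mp hp))

lemma holds_eliminate [IsAlgClosed K] (x : V) (φ : List (Cell V)) (ρ : V → K) :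
    Holds (eliminate x φ) ρ ↔ ∃ a, Holds φ (Function.update ρ x a) := by
  simp only [Holds, eliminate, List.mem_flatMap]
  constructor
  · rintro ⟨c', ⟨c, hc, hc'⟩, h⟩
    obtain ⟨a, ha⟩ := (holds_spanCase x c ρ).mp ((holds_spanCells x _ ρ).mpr ⟨c', hc', h⟩)
    exact ⟨a, c, hc, ha⟩
  · rintro ⟨a, c, hc, ha⟩
    obtain ⟨c', hc', h⟩ := (holds_spanCells x _ ρ).mp ((holds_spanCase x c ρ).mpr ⟨a, ha⟩)
    exact ⟨c', ⟨c, hc, hc'⟩, h⟩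

lemma holds_foldl_eliminate [IsAlgClosed K] (xs : List V) (φ : List (Cell V)) (ρ : V → K) :
    Holds (xs.foldl (fun φ x => eliminate x φ) φ) ρ ↔
      ∃ ρ' : V → K, (∀ y, y ∉ xs → ρ' y = ρ y) ∧ Holds φ ρ' := by
  induction xs generalizing φ with
  | nil =>
    simp only [List.foldl_nil, List.not_mem_nil, not_false_eq_true, true_imp_iff]
    constructor
    · exact fun h => ⟨ρ, fun _ => rfl, h⟩
    · rintro ⟨ρ', h, h'⟩
      rwa [← funext h]
  | cons x xs ih =>
    rw [List.foldl_cons, ih]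
    constructor
    · rintro ⟨ρ', h, h'⟩
      obtain ⟨a, ha⟩ := (holds_eliminate x φ ρ').mp h'
      refine ⟨_, fun y hy => ?_, ha⟩
      rw [List.mem_cons, not_or] at hy
      rw [Function.update_of_ne hy.1, h y hy.2]
    · rintro ⟨ρ', h, h'⟩
      -- If `x` is eliminated again later, its value is free; otherwise it must be reset to `ρ x`,
      -- and `ρ' x` serves as the witness for the quantifier.
      by_cases hx : x ∈ xs
      · refine ⟨ρ', fun y hy => h y ?_, (holds_eliminate x φ ρ').mpr ⟨ρ' x, by simpa using h'⟩⟩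
        rw [List.mem_cons, not_or]
        exact ⟨fun hyx => hy (hyx ▸ hx), hy⟩
      · refine ⟨Function.update ρ' x (ρ x), fun y hy => ?_,
          (holds_eliminate x φ _).mpr ⟨ρ' x, by simpa using h'⟩⟩
        by_cases hyx : y = x
        · subst hyx; simp
        · rw [Function.update_of_ne hyx]
          exact h y (by simp [hyx, hy])

end SignedPoly

/-! ### The elimination is primitive recursive -/

namespace SignedPoly

section Primrec

open Primrec

variable {α V : Type*} [Primcodable α] [Primcodable V]

lemma primrec_mul {f g : α → SignedPoly V} (hf : Primrec f) (hg : Primrec g) :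
    Primrec fun a => mul (f a) (g a) := by
  refine list_flatMap hf (list_map (hg.comp fst) (pair ?_ ?_))
  · exact (dom_bool₂ (fun a b => a == b)).comp (fst.comp (snd.comp fst)) (fst.comp snd)
  · exact list_append.comp (snd.comp (snd.comp fst)) (snd.comp snd)

lemma primrec_neg {f : α → SignedPoly V} (hf : Primrec f) : Primrec fun a => neg (f a) :=
  list_map hf (pair ((dom_bool not).comp (fst.comp snd)) (snd.comp snd))

lemma primrec_pow {f : α → SignedPoly V} {g : α → ℕ} (hf : Primrec f) (hg : Primrec g) :
    Primrec fun a => pow (f a) (g a) :=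
  nat_iterate hg (Primrec.const _) (primrec_mul (hf.comp fst) snd)

lemma primrec_weight {f : α → SignedPoly V} (hf : Primrec f) : Primrec fun a => weight (f a) :=
  list_length.comp (list_flatMap hf (snd.comp snd))

lemma primrec_cellWeight {f : α → Cell V} (hf : Primrec f) :
    Primrec fun a => Cell.weight (f a) :=
  list_length.comp (list_flatMap hf (list_flatMap (fst.comp snd) (snd.comp snd)))

lemma primrec_equations {f : α → Cell V} (hf : Primrec f) :
    Primrec fun a => Cell.equations (f a) :=
  list_flatMap hf (Primrec.cond (snd.comp snd)
    (list_cons.comp (fst.comp snd) (Primrec.const [])) (Primrec.const []))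

lemma primrec_inequation {f : α → Cell V} (hf : Primrec f) :
    Primrec fun a => Cell.inequation (f a) :=
  list_foldr (h := fun _ (p : (SignedPoly V × Bool) × SignedPoly V) =>
      bif p.1.2 then p.2 else mul p.1.1 p.2) hf (Primrec.const _)
    (Primrec.cond (snd.comp (fst.comp snd)) (snd.comp snd)
      (primrec_mul (fst.comp (fst.comp snd)) (snd.comp snd)))

lemma primrec_range_succ {f : α → ℕ} (hf : Primrec f) :
    Primrec fun a => List.range (f a + 1) :=
  list_range.comp (succ.comp hf)

lemma primrec_shift {f : α → V} {g : α → ℕ} {h : α → SignedPoly V} (hf : Primrec f)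
    (hg : Primrec g) (hh : Primrec h) : Primrec fun a => shift (f a) (g a) (h a) :=
  primrec_mul (list_cons.comp (pair (Primrec.const true)
    (list_map (list_range.comp hg) (hf.comp fst))) (Primrec.const [])) hh

lemma primrec_spanCase {f : α → V} {c : α → Cell V} (hf : Primrec f) (hc : Primrec c) :
    Primrec fun a => spanCase (f a) (c a) := by
  have hw := primrec_cellWeight hc
  refine pair (Primrec.const []) (pair (primrec_pow (primrec_inequation hc) (succ.comp hw))
    (list_flatMap (primrec_equations hc) (list_map ?_ ?_)))
  · exact (primrec_range_succ (nat_add.comp (nat_mul.comp (succ.comp hw) hw)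
      (nat_mul.comp (Primrec.const 2) hw))).comp fst
  · exact primrec_shift (hf.comp (fst.comp fst)) snd (snd.comp fst)

variable [DecidableEq V]

lemma primrec_without {f : α → V} {g : α → List V} (hf : Primrec f) (hg : Primrec g) :
    Primrec fun a => without (f a) (g a) :=
  list_flatMap hg (Primrec.ite (Primrec.eq.comp snd (hf.comp fst)) (Primrec.const [])
    (list_cons.comp snd (Primrec.const [])))

lemma primrec_mult {f : α → V} {g : α → List V} (hf : Primrec f) (hg : Primrec g) :
    Primrec fun a => mult (f a) (g a) :=
  nat_sub.comp (list_length.comp hg) (list_length.comp (primrec_without hf hg))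

lemma primrec_coeff {f : α → V} {g : α → ℕ} {h : α → SignedPoly V} (hf : Primrec f)
    (hg : Primrec g) (hh : Primrec h) : Primrec fun a => coeff (f a) (g a) (h a) :=
  list_flatMap hh (Primrec.ite
    (Primrec.eq.comp (primrec_mult (hf.comp fst) (snd.comp snd)) (hg.comp fst))
    (list_cons.comp (pair (fst.comp snd) (primrec_without (hf.comp fst) (snd.comp snd)))
      (Primrec.const [])) (Primrec.const []))

lemma primrec_cancel {f : α → V} {g : α → ℕ} {w u : α → SignedPoly V} (hf : Primrec f)
    (hg : Primrec g) (hw : Primrec w) (hu : Primrec u) :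
    Primrec fun a => cancel (f a) (g a) (w a) (u a) :=
  list_append.comp (primrec_mul (primrec_coeff hf hg hw) hu)
    (primrec_neg (primrec_mul (primrec_coeff hf hg hu) hw))

lemma primrec_vanish {f : α → V} {w : α → SignedPoly V} (hf : Primrec f) (hw : Primrec w) :
    Primrec fun a => vanish (f a) (w a) :=
  list_map (primrec_range_succ (primrec_weight hw))
    (pair (primrec_coeff (hf.comp fst) snd (hw.comp fst)) (Primrec.const true))

lemma primrec_singleton_ne {f : α → V} {i : α → ℕ} {w : α → SignedPoly V} {c : α → Cell V}
    (hf : Primrec f) (hi : Primrec i) (hw : Primrec w) (hc : Primrec c) :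
    Primrec fun a => c a ++ [(coeff (f a) (i a) (w a), false)] :=
  list_append.comp hc (list_cons.comp (pair (primrec_coeff hf hi hw) (Primrec.const false))
    (Primrec.const []))

lemma primrec_pivot {f : α → V} {s : α → SpanCase V} (hf : Primrec f) (hs : Primrec s) :
    Primrec fun a => pivot (f a) (s a) := by
  have hcell : Primrec fun a => (s a).1 := fst.comp hs
  have hv : Primrec fun a => (s a).2.1 := fst.comp (snd.comp hs)
  refine (list_casesOn (h := fun a (p : SignedPoly V × List (SignedPoly V)) =>
      ((s a).1 ++ vanish (f a) p.1, (s a).2.1, p.2) ::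
      (List.range (weight p.1 + 1)).map fun i =>
        ((s a).1 ++ [(coeff (f a) i p.1, false)], cancel (f a) i p.1 (s a).2.1,
          p.2.map (cancel (f a) i p.1))) (snd.comp (snd.comp hs))
    (list_cons.comp hs (Primrec.const [])) ?_).of_eq fun a => ?_
  · refine list_cons.comp (pair ?_ (pair (hv.comp fst) (snd.comp snd))) (list_map ?_ ?_)
    · exact list_append.comp (hcell.comp fst) (primrec_vanish (hf.comp fst) (fst.comp snd))
    · exact primrec_range_succ (primrec_weight (fst.comp snd))
    · refine pair ?_ (pair ?_ (list_map ?_ ?_))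
      · exact primrec_singleton_ne (hf.comp (fst.comp fst)) snd (fst.comp (snd.comp fst))
          (hcell.comp (fst.comp fst))
      · exact primrec_cancel (hf.comp (fst.comp fst)) snd (fst.comp (snd.comp fst))
          (hv.comp (fst.comp fst))
      · exact snd.comp (snd.comp fst)
      · exact primrec_cancel (hf.comp (fst.comp (fst.comp fst))) (snd.comp fst)
          (fst.comp (snd.comp (fst.comp fst))) snd
  · obtain ⟨c, v, ws⟩ := s a
    cases ws <;> rfl

lemma primrec_spanCells {f : α → V} {s : α → SpanCase V} (hf : Primrec f) (hs : Primrec s) :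
    Primrec fun a => spanCells (f a) (s a) := by
  have h : Primrec fun a => pivots (f a) (s a) :=
    nat_iterate (list_length.comp (snd.comp (snd.comp hs))) (list_cons.comp hs (Primrec.const []))
      (list_flatMap snd (primrec_pivot (hf.comp (fst.comp fst)) snd))
  refine list_flatMap h (list_map ?_ ?_)
  · exact primrec_range_succ (primrec_weight (fst.comp (snd.comp snd)))
  · exact primrec_singleton_ne (hf.comp (fst.comp fst)) snd
      (fst.comp (snd.comp (snd.comp fst))) (fst.comp (snd.comp fst))

lemma primrec_eliminate {f : α → V} {φ : α → List (Cell V)} (hf : Primrec f) (hφ : Primrec φ) :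
    Primrec fun a => eliminate (f a) (φ a) :=
  list_flatMap hφ (primrec_spanCells (hf.comp fst) (primrec_spanCase (hf.comp fst) snd))

lemma primrec_foldl_eliminate {xs : α → List V} {φ : α → List (Cell V)} (hxs : Primrec xs)
    (hφ : Primrec φ) : Primrec fun a => (xs a).foldl (fun φ x => eliminate x φ) (φ a) :=
  list_foldl (h := fun _ (p : List (Cell V) × V) => eliminate p.2 p.1) hxs hφ
    (primrec_eliminate (snd.comp snd) (fst.comp snd))

end Primrec

end SignedPoly

/-! ### Remainders modulo a polynomial in some of the variables -/

namespace MvPolynomial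

variable {σ σ' τ K : Type*} [Field K]

/-- No monomial of `r` is divisible by the leading monomial of `b`. -/
def IsRemainder (m : MonomialOrder τ) (b r : MvPolynomial τ K) : Prop :=
  ∀ c ∈ r.support, ¬ m.degree b ≤ c

lemma IsRemainder.eq_zero_of_dvd {m : MonomialOrder τ} {b r : MvPolynomial τ K}
    (hr : IsRemainder m b r) (h : b ∣ r) : r = 0 := by
  by_contra h0
  obtain ⟨a, rfl⟩ := h
  refine hr _ (m.degree_mem_support h0) ?_
  rw [m.degree_mul' h0]
  exact le_self_add

lemma exists_eq_mul_add_isRemainder (m : MonomialOrder τ) {b : MvPolynomial τ K} (hb : b ≠ 0)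
    (f : MvPolynomial τ K) :
    ∃ q r, f = q * b + r ∧ m.toSyn (m.degree (b * q)) ≤ m.toSyn (m.degree f) ∧
      IsRemainder m b r :=
  m.div_single (isUnit_iff_ne_zero.mpr (m.leadingCoeff_ne_zero_iff.mpr hb)) f

lemma apply_eq_zero_of_mem_support_rename {ι : σ → τ} {G : MvPolynomial σ K} {c : τ →₀ ℕ}
    (hc : c ∈ (rename ι G).support) {i : τ} (hi : i ∉ Set.range ι) : c i = 0 := by
  obtain ⟨u, rfl, -⟩ := coeff_rename_ne_zero _ _ _ (mem_support_iff.mp hc)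
  exact Finsupp.mapDomain_of_notMem_range _ _ hi

/-- The leading monomial of `rename ι G` involves only variables in the range of `ι`, and the factor
`rename κ H` does not change the exponents of these. -/
lemma IsRemainder.mul_rename {m : MonomialOrder τ} {ι : σ → τ} {κ : σ' → τ}
    (hικ : ∀ i j, ι i ≠ κ j) {G : MvPolynomial σ K} {H : MvPolynomial σ' K} {r : MvPolynomial τ K}
    (hr : IsRemainder m (rename ι G) r) : IsRemainder m (rename ι G) (r * rename κ H) := by
  classical
  intro c hc hle
  obtain ⟨c₁, hc₁, c₂, hc₂, rfl⟩ := Finset.mem_add.mp (support_mul _ _ hc)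
  refine hr c₁ hc₁ fun i => ?_
  by_cases hi : i ∈ Set.range ι
  · obtain ⟨j, rfl⟩ := hi
    have h2 : c₂ (ι j) = 0 := apply_eq_zero_of_mem_support_rename hc₂ (by
      rintro ⟨k, hk⟩; exact hικ j k hk.symm)
    simpa [h2] using hle (ι j)
  · by_cases hb : rename ι G = 0
    · simp [hb]
    · rw [apply_eq_zero_of_mem_support_rename (m.degree_mem_support hb) hi]
      exact Nat.zero_le _

/-- Substitution of constants for the variables outside the range of `ι`. -/
noncomputable def specialize (ι : σ → τ) (P : τ → K) : MvPolynomial τ K →ₐ[K] MvPolynomial σ K :=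
  aeval (Function.extend ι X fun i => C (P i))

lemma eval_specialize {ι : σ → τ} (hι : Function.Injective ι) (P : τ → K) (a : σ → K)
    (f : MvPolynomial τ K) :
    eval a (specialize ι P f) = eval (Function.extend ι a P) f := by
  have h : (eval a).comp (specialize ι P : MvPolynomial τ K →+* MvPolynomial σ K) =
      eval (Function.extend ι a P) := by
    refine ringHom_ext (fun c => by simp [specialize]) fun i => ?_
    by_cases hi : ∃ j, ι j = i
    · obtain ⟨j, rfl⟩ := hi
      simp [specialize, hι.extend_apply]
    · simp [specialize, Function.extend_apply' _ _ _ hi]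
  exact RingHom.congr_fun h f

lemma exists_prod_extend_eq_monomial {ι : σ → τ} (hι : Function.Injective ι) (P : τ → K)
    (c : τ →₀ ℕ) : ∃ k : K,
      (c.prod fun i n => (Function.extend ι X (fun i => C (P i)) i : MvPolynomial σ K) ^ n) =
        monomial (c.comapDomain ι hι.injOn) k := by
  classical
  induction c using Finsupp.induction_linear with
  | zero => exact ⟨1, by simp⟩
  | add c c' h h' =>
    obtain ⟨k, hk⟩ := h
    obtain ⟨k', hk'⟩ := h'
    refine ⟨k * k', ?_⟩
    rw [Finsupp.prod_add_index' (by simp) (by simp [pow_add]), hk, hk', monomial_mul,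
      Finsupp.comapDomain_add_of_injective hι]
  | single i n =>
    rw [Finsupp.prod_single_index (by simp)]
    by_cases hi : ∃ j, ι j = i
    · obtain ⟨j, rfl⟩ := hi
      refine ⟨1, ?_⟩
      rw [hι.extend_apply, Finsupp.comapDomain_single, X_pow_eq_monomial]
    · refine ⟨P i ^ n, ?_⟩
      have h0 : (Finsupp.single i n).comapDomain ι hι.injOn = 0 := by
        ext j
        have : ι j ≠ i := fun h => hi ⟨j, h⟩
        simp [this.symm]
      rw [Function.extend_apply' _ _ _ hi, h0, ← map_pow]
      rfl

/-- The exponents that survive specialization are restrictions of exponents of `r` to the variables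
of `G`, and only these variables matter for divisibility by the leading monomial. -/
lemma IsRemainder.specialize {m : MonomialOrder τ} {ι : σ → τ} (hι : Function.Injective ι)
    {G : MvPolynomial σ K} {r : MvPolynomial τ K} (hr : IsRemainder m (rename ι G) r)
    (P : τ → K) : IsRemainder m (rename ι G) (rename ι (specialize ι P r)) := by
  classical
  intro c hc hle
  obtain ⟨u, rfl, hu⟩ := coeff_rename_ne_zero _ _ _ (mem_support_iff.mp hc)
  obtain ⟨c', hc', rfl⟩ : ∃ c' ∈ r.support, u = c'.comapDomain ι hι.injOn := by
    by_contra! hcon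
    refine hu ?_
    rw [MvPolynomial.specialize, aeval_def, eval₂_eq, coeff_sum]
    refine Finset.sum_eq_zero fun d hd => ?_
    obtain ⟨k, hk⟩ := exists_prod_extend_eq_monomial hι P d
    rw [Finsupp.prod] at hk
    rw [hk, algebraMap_eq, coeff_C_mul, coeff_monomial, if_neg (hcon d hd).symm, mul_zero]
  refine hr c' hc' fun i => ?_
  by_cases hi : i ∈ Set.range ι
  · obtain ⟨j, rfl⟩ := hi
    simpa [Finsupp.mapDomain_apply hι] using hle (ι j)
  · by_cases hb : rename ι G = 0
    · simp [hb]
    · rw [apply_eq_zero_of_mem_support_rename (m.degree_mem_support hb) hi]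
      exact Nat.zero_le _

/-- An irreducible `G` generates a prime ideal, which is the full vanishing ideal of its zero set by
the Nullstellensatz. -/
lemma dvd_of_eval_eq_zero [IsAlgClosed K] [Finite σ] {G f : MvPolynomial σ K} (hG : Irreducible G)
    (h : ∀ a, eval a G = 0 → eval a f = 0) : G ∣ f := by
  have hp : (Ideal.span {G}).IsPrime :=
    (Ideal.span_singleton_prime hG.ne_zero).mpr (UniqueFactorizationMonoid.irreducible_iff_prime.mp hG)
  rw [← Ideal.mem_span_singleton, ← IsPrime.vanishingIdeal_zeroLocus (K := K) (Ideal.span {G})]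
  rw [mem_vanishingIdeal_iff]
  intro a ha
  rw [mem_zeroLocus_iff] at ha
  simpa [aeval_eq_eval] using h a (by simpa [aeval_eq_eval] using ha G (Ideal.mem_span_singleton_self G))

/-- Freeze the variables outside the range of `ι` at their values in `P`. The specialized `r`
vanishes on the zeros of `G`, hence is divisible by `G`; being a remainder as well, it is zero. -/
lemma IsRemainder.eval_eq_zero [IsAlgClosed K] [Finite σ] {m : MonomialOrder τ} {ι : σ → τ}
    (hι : Function.Injective ι) {G : MvPolynomial σ K} (hG : Irreducible G)
    {q r : MvPolynomial τ K} (hr : IsRemainder m (rename ι G) r) {P : τ → K}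
    (h : ∀ a, eval a G = 0 → eval (Function.extend ι a P) (q * rename ι G + r) = 0) :
    eval P r = 0 := by
  have hdvd : G ∣ MvPolynomial.specialize ι P r := by
    refine dvd_of_eval_eq_zero hG fun a ha => ?_
    have h1 := h a ha
    have h2 : Function.extend ι a P ∘ ι = a := Function.extend_comp hι _ _
    rw [map_add, map_mul, eval_rename, h2, ha, mul_zero, zero_add] at h1
    rw [eval_specialize hι, h1]
  have h0 := (hr.specialize hι P).eq_zero_of_dvd (map_dvd (rename ι) hdvd)
  have h1 : MvPolynomial.specialize ι P r = 0 := rename_injective ι hι (by rw [h0, map_zero])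
  have h2 := eval_specialize hι P (P ∘ ι) r
  have h3 : Function.extend ι (P ∘ ι) P = P := by
    funext i
    by_cases hi : ∃ j, ι j = i
    · obtain ⟨j, rfl⟩ := hi
      simp [hι.extend_apply]
    · simp [Function.extend_apply' _ _ _ hi]
  rw [h1, h3, map_zero] at h2
  exact h2.symm

lemma one_le_totalDegree_of_irreducible {G : MvPolynomial σ K} (hG : Irreducible G) :
    1 ≤ G.totalDegree := by
  rw [Nat.one_le_iff_ne_zero]
  intro h
  rw [totalDegree_eq_zero_iff_eq_C] at h
  have h0 : coeff 0 G ≠ 0 := fun h0 => hG.ne_zero (by rw [h, h0, map_zero])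
  exact hG.not_isUnit (by rw [h]; exact (isUnit_iff_ne_zero.mpr h0).map C)

lemma exists_irreducible_dvd {G : MvPolynomial σ K} (hG : ∀ c, G ≠ C c) :
    ∃ P, Irreducible P ∧ P ∣ G := by
  refine WfDvdMonoid.exists_irreducible_factor (fun hu => ?_) (fun h => hG 0 (by rw [h, map_zero]))
  obtain ⟨c, -, hc⟩ := isUnit_iff_eq_C_of_isReduced.mp hu
  exact hG c hc

lemma totalDegree_rename {ι : σ → τ} (hι : Function.Injective ι) (G : MvPolynomial σ K) :
    (rename ι G).totalDegree = G.totalDegree := by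
  refine (totalDegree_rename_le ι G).antisymm ?_
  refine Finset.sup_le fun u hu => ?_
  have h : u.mapDomain ι ∈ (rename ι G).support := by
    rw [mem_support_iff, coeff_rename_mapDomain _ hι]
    exact mem_support_iff.mp hu
  have h' := le_totalDegree h
  rwa [Finsupp.sum_mapDomain_index (by simp) (by simp)] at h'

end MvPolynomial

/-! ### Degree control and the vanishing criterion -/

namespace CartesianPoly

abbrev placeXY : Fin 2 → Fin 4 := ![0, 1]
abbrev placeZT : Fin 2 → Fin 4 := ![2, 3]

lemma placeXY_injective : Function.Injective placeXY := by decide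
lemma placeZT_injective : Function.Injective placeZT := by decide
lemma placeXY_ne_placeZT : ∀ i j, placeXY i ≠ placeZT j := by decide

lemma totalDegree_degLex_le {b q f : MvPolynomial (Fin 4) ℂ}
    (h : MonomialOrder.degLex.toSyn (MonomialOrder.degLex.degree (b * q)) ≤
      MonomialOrder.degLex.toSyn (MonomialOrder.degLex.degree f)) :
    (b * q).totalDegree ≤ f.totalDegree :=
  degLex_totalDegree_monotone h

/-- A member of the ideal of `G(x,y)` and `H(z,t)` is a combination without cancellation. -/
lemma exists_combination_totalDegree_le {G H : MvPolynomial (Fin 2) ℂ} (hG : G ≠ 0)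
    {F F₁ F₂ : MvPolynomial (Fin 4) ℂ}
    (hF : F = rename placeXY G * F₁ + rename placeZT H * F₂) :
    ∃ E₁ E₂ : MvPolynomial (Fin 4) ℂ, F = rename placeXY G * E₁ + rename placeZT H * E₂ ∧
      (rename placeXY G * E₁).totalDegree ≤ F.totalDegree ∧
      (rename placeZT H * E₂).totalDegree ≤ F.totalDegree := by
  have hb : rename placeXY G ≠ 0 := (rename_injective _ placeXY_injective).ne_iff' (map_zero _) |>.mpr hG
  obtain ⟨q, r, hqr, hdeg, hr⟩ := exists_eq_mul_add_isRemainder MonomialOrder.degLex hb F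
  obtain ⟨q', r', hqr', -, hr'⟩ := exists_eq_mul_add_isRemainder MonomialOrder.degLex hb F₂
  have hr'' : IsRemainder MonomialOrder.degLex (rename placeXY G) (r' * rename placeZT H) :=
    hr'.mul_rename placeXY_ne_placeZT
  -- Both terms are remainders modulo `G`, and their difference is a multiple of `G`.
  have h0 : r - r' * rename placeZT H = 0 := by
    refine IsRemainder.eq_zero_of_dvd (m := MonomialOrder.degLex) (b := rename placeXY G) ?_
      ⟨F₁ - q + rename placeZT H * q', ?_⟩
    · intro c hc
      classical
      rcases Finset.mem_union.mp (support_sub _ _ _ hc) with h | h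
      · exact hr c h
      · exact hr'' c h
    · linear_combination hF - hqr + rename placeZT H * hqr'
  have hq := totalDegree_degLex_le hdeg
  refine ⟨q, r', by rw [hqr]; linear_combination h0, hq, ?_⟩
  have : rename placeZT H * r' = F - rename placeXY G * q := by
    linear_combination -hqr - h0
  rw [this]
  exact (totalDegree_sub _ _).trans (max_le le_rfl hq)

/-- For irreducible factors `A`, `B`, divide `F` by `A` and then the remainder by `B`. The first
remainder vanishes wherever `B` does, whatever `x, y` are; therefore the second one vanishes
everywhere. -/
lemma isCartesian_of_vanishing {F : MvPolynomial (Fin 4) ℂ} {G H : MvPolynomial (Fin 2) ℂ}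
    (hG : ∀ c, G ≠ C c) (hH : ∀ c, H ≠ C c)
    (h : ∀ P : Fin 4 → ℂ, eval (P ∘ placeXY) G = 0 → eval (P ∘ placeZT) H = 0 → eval P F = 0) :
    IsCartesian F := by
  obtain ⟨A, hA, hAG⟩ := exists_irreducible_dvd hG
  obtain ⟨B, hB, hBH⟩ := exists_irreducible_dvd hH
  have h' : ∀ P : Fin 4 → ℂ, eval (P ∘ placeXY) A = 0 → eval (P ∘ placeZT) B = 0 →
      eval P F = 0 := fun P hPA hPB => h P (eq_zero_of_zero_dvd (hPA ▸ map_dvd (eval _) hAG))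
    (eq_zero_of_zero_dvd (hPB ▸ map_dvd (eval _) hBH))
  have hA0 := (rename_injective _ placeXY_injective).ne_iff' (map_zero _) |>.mpr hA.ne_zero
  have hB0 := (rename_injective _ placeZT_injective).ne_iff' (map_zero _) |>.mpr hB.ne_zero
  obtain ⟨q, r, hqr, -, hr⟩ := exists_eq_mul_add_isRemainder MonomialOrder.degLex hA0 F
  obtain ⟨q', r', hqr', -, hr'⟩ := exists_eq_mul_add_isRemainder MonomialOrder.degLex hB0 r
  have h1 : ∀ P : Fin 4 → ℂ, eval (P ∘ placeZT) B = 0 → eval P r = 0 := by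
    intro P hP
    refine hr.eval_eq_zero placeXY_injective hA (q := q) fun a ha => ?_
    rw [← hqr]
    refine h' _ (by rwa [Function.extend_comp placeXY_injective]) ?_
    have : Function.extend placeXY a P ∘ placeZT = P ∘ placeZT := by
      funext j
      refine Function.extend_apply' _ _ _ ?_
      rintro ⟨i, hi⟩
      exact placeXY_ne_placeZT i j hi
    rwa [this]
  have h2 : r' = 0 := by
    refine MvPolynomial.funext fun P => ?_
    rw [map_zero]
    refine hr'.eval_eq_zero placeZT_injective hB (q := q') fun a ha => ?_
    rw [← hqr']
    refine h1 _ (by rwa [Function.extend_comp placeZT_injective])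
  have hnc : ∀ {P : MvPolynomial (Fin 2) ℂ}, Irreducible P → ∀ c, P ≠ C c := by
    rintro P hP c rfl
    simpa using one_le_totalDegree_of_irreducible hP
  exact ⟨A, B, hnc hA, hnc hB, q, q', by rw [hqr, hqr', h2]; ring⟩

lemma irreducible_X_zero : Irreducible (X 0 : MvPolynomial (Fin 2) ℂ) :=
  (MvPolynomial.X_prime (i := 0)).irreducible

/-- A nonzero cofactor bounds the degree of its irreducible factor by that of `F`. If a cofactor is
zero, its factor is arbitrary and is replaced by a variable; the cofactors are not both zero since
`F ≠ 0`. -/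
lemma IsCartesian.exists_irreducible {F : MvPolynomial (Fin 4) ℂ} (hF : IsCartesian F)
    (hF0 : F ≠ 0) :
    ∃ (G H : MvPolynomial (Fin 2) ℂ) (F₁ F₂ : MvPolynomial (Fin 4) ℂ),
      Irreducible G ∧ Irreducible H ∧ G.totalDegree ≤ F.totalDegree ∧
      H.totalDegree ≤ F.totalDegree ∧ F = rename placeXY G * F₁ + rename placeZT H * F₂ ∧
      (rename placeXY G * F₁).totalDegree ≤ F.totalDegree ∧
      (rename placeZT H * F₂).totalDegree ≤ F.totalDegree := by
  obtain ⟨G₀, H₀, hG₀, hH₀, E₁, E₂, hE⟩ := hF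
  obtain ⟨G, hG, A, rfl⟩ := exists_irreducible_dvd hG₀
  obtain ⟨H, hH, B, rfl⟩ := exists_irreducible_dvd hH₀
  obtain ⟨F₁, F₂, h, h₁, h₂⟩ := exists_combination_totalDegree_le (F := F) (H := H)
    (F₁ := rename placeXY A * E₁) (F₂ := rename placeZT B * E₂) hG.ne_zero
    (by rw [hE]; simp only [map_mul]; ring)
  have hle : ∀ {κ : Fin 2 → Fin 4}, Function.Injective κ → ∀ {P : MvPolynomial (Fin 2) ℂ}
      {E : MvPolynomial (Fin 4) ℂ}, Irreducible P → E ≠ 0 →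
      (rename κ P * E).totalDegree ≤ F.totalDegree → P.totalDegree ≤ F.totalDegree := by
    intro κ hκ P E hP hE0 hPE
    have hP0 := (rename_injective _ hκ).ne_iff' (map_zero _) |>.mpr hP.ne_zero
    rw [totalDegree_mul_of_isDomain hP0 hE0, totalDegree_rename hκ] at hPE
    omega
  have hX : ∀ {P : MvPolynomial (Fin 2) ℂ}, Irreducible P → P.totalDegree ≤ F.totalDegree →
      (X 0 : MvPolynomial (Fin 2) ℂ).totalDegree ≤ F.totalDegree := by
    intro P hP hPF
    rw [totalDegree_X]
    exact (one_le_totalDegree_of_irreducible hP).trans hPF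
  by_cases h₁0 : F₁ = 0
  · have hH' := hle placeZT_injective hH (fun h0 => hF0 (by rw [h, h₁0, h0]; simp)) h₂
    exact ⟨X 0, H, 0, F₂, irreducible_X_zero, hH, hX hH hH', hH', by rw [h, h₁0]; simp,
      by simp, h₂⟩
  · have hG' := hle placeXY_injective hG h₁0 h₁
    by_cases h₂0 : F₂ = 0
    · exact ⟨G, X 0, F₁, 0, hG, irreducible_X_zero, hG', hX hG hG', by rw [h, h₂0]; simp, h₁,
        by simp⟩
    · exact ⟨G, H, F₁, F₂, hG, hH, hG', hle placeZT_injective hH h₂0 h₂, h, h₁, h₂⟩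

end CartesianPoly

namespace CartesianPoly

/-! ### The first-order formula of bounded degree -/

/-- All exponent vectors with entries at most `n`. -/
def box (n : ℕ) : List Mono :=
  (List.range (n + 1)).flatMap fun i => (List.range (n + 1)).flatMap fun j =>
    (List.range (n + 1)).flatMap fun k => (List.range (n + 1)).map fun l => (i, j, k, l)

def boxXY (n : ℕ) : List Mono :=
  (List.range (n + 1)).flatMap fun i => (List.range (n + 1)).map fun j => (i, j, 0, 0)

def boxZT (n : ℕ) : List Mono :=
  (List.range (n + 1)).flatMap fun k => (List.range (n + 1)).map fun l => (0, 0, k, l)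

def monoValue (P m : Mono) : ℕ := P.1 ^ m.1 * P.2.1 ^ m.2.1 * P.2.2.1 ^ m.2.2.1 * P.2.2.2 ^ m.2.2.2

/-- The unknown that stands for the coefficient of `m` in the `k`-th unknown polynomial; its first
entry is at least `n`. -/
def unknown (n k : ℕ) (m : Mono) : Mono := (n + k + 4 * m.1, m.2)

/-- The value at a point of the polynomial with monomials in `l` and coefficients `v m`. -/
def valueAt (l : List Mono) (v : Mono → Mono) (P : Mono) : SignedPoly Mono :=
  l.flatMap fun m => (List.range (monoValue P m)).map fun _ => (true, [v m])

/-- The equation `-F + G F₁ + H F₂ = 0` at the point `P`, where `F` has degree at most `d`. -/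
def identityAt (d : ℕ) (P : Mono) : SignedPoly Mono :=
  SignedPoly.neg (valueAt (box d) (fun m => m) P) ++
    (SignedPoly.mul (valueAt (boxXY (d + 1)) (unknown (d + 1) 0) P)
        (valueAt (box (d + 1)) (unknown (d + 1) 2) P) ++
      SignedPoly.mul (valueAt (boxZT (d + 1)) (unknown (d + 1) 1) P)
        (valueAt (box (d + 1)) (unknown (d + 1) 3) P))

/-- Both sides have degree at most `2 * (d + 1)` in each variable, so agreement on the integer grid
`0, …, 2 * (d + 1)` is agreement as polynomials. -/
def identityCell (d : ℕ) : SignedPoly.Cell Mono :=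
  (box (2 * (d + 1))).map fun P => (identityAt d P, true)

def nonconstLiteral (n k : ℕ) (m : Mono) : SignedPoly Mono × Bool :=
  ([(true, [unknown n k m])], false)

/-- Non-constancy is a disjunction over the choice of one non-constant monomial for each of `G` and
`H`. -/
def startFormula (d : ℕ) : List (SignedPoly.Cell Mono) :=
  (SignedPoly.without (0, 0, 0, 0) (boxXY (d + 1))).flatMap fun m =>
    (SignedPoly.without (0, 0, 0, 0) (boxZT (d + 1))).map fun m' =>
      identityCell d ++ [nonconstLiteral (d + 1) 0 m, nonconstLiteral (d + 1) 1 m']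

/-- The size `4 * n + 3` accommodates first entries `k + 4 * m.1` with `k ≤ 3` and `m.1 ≤ n`. The
surplus names do not occur in the formula, so eliminating them is harmless. -/
def unknowns (n : ℕ) : List Mono := (box (4 * n + 3)).map fun m => (n + m.1, m.2)

/-- The equivalent integer polynomial. -/
def toCoeffPoly (p : SignedPoly Mono) : CoeffPoly := p.map fun s => (bif s.1 then 1 else -1, s.2)

def cartesianTests (d : ℕ) : ZeroTests :=
  ((unknowns (d + 1)).foldl (fun φ x => SignedPoly.eliminate x φ) (startFormula d)).map fun c =>
    c.map fun s => (toCoeffPoly s.1, s.2)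

/-! ### The tests are primitive recursive in the degree -/

section Primrec

open Primrec

lemma primrec_box {α : Type*} [Primcodable α] {f : α → ℕ} (hf : Primrec f) :
    Primrec fun a => box (f a) := by
  have h := SignedPoly.primrec_range_succ hf
  refine list_flatMap h (list_flatMap (h.comp fst) (list_flatMap (h.comp (fst.comp fst))
    (list_map (h.comp (fst.comp (fst.comp fst))) ?_)))
  exact pair (snd.comp (fst.comp (fst.comp fst))) (pair (snd.comp (fst.comp fst))
    (pair (snd.comp fst) snd))

lemma primrec_boxXY {α : Type*} [Primcodable α] {f : α → ℕ} (hf : Primrec f) :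
    Primrec fun a => boxXY (f a) := by
  have h := SignedPoly.primrec_range_succ hf
  exact list_flatMap h (list_map (h.comp fst)
    (pair (snd.comp fst) (pair snd (Primrec.const (0, 0)))))

lemma primrec_boxZT {α : Type*} [Primcodable α] {f : α → ℕ} (hf : Primrec f) :
    Primrec fun a => boxZT (f a) := by
  have h := SignedPoly.primrec_range_succ hf
  exact list_flatMap h (list_map (h.comp fst)
    (pair (Primrec.const 0) (pair (Primrec.const 0) (pair (snd.comp fst) snd))))

lemma primrec_pow_nat : Primrec₂ ((· ^ ·) : ℕ → ℕ → ℕ) :=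
  Primrec₂.unpaired'.1 Nat.Primrec.pow

lemma primrec_monoValue {α : Type*} [Primcodable α] {f g : α → Mono} (hf : Primrec f)
    (hg : Primrec g) : Primrec fun a => monoValue (f a) (g a) :=
  nat_mul.comp (nat_mul.comp (nat_mul.comp (primrec_pow_nat.comp (fst.comp hf) (fst.comp hg))
    (primrec_pow_nat.comp (fst.comp (snd.comp hf)) (fst.comp (snd.comp hg))))
    (primrec_pow_nat.comp (fst.comp (snd.comp (snd.comp hf))) (fst.comp (snd.comp (snd.comp hg)))))
    (primrec_pow_nat.comp (snd.comp (snd.comp (snd.comp hf))) (snd.comp (snd.comp (snd.comp hg))))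

lemma primrec_unknown {α : Type*} [Primcodable α] {n : α → ℕ} (k : ℕ) {m : α → Mono}
    (hn : Primrec n) (hm : Primrec m) : Primrec fun a => unknown (n a) k (m a) :=
  pair (nat_add.comp (nat_add.comp hn (Primrec.const k))
    (nat_mul.comp (Primrec.const 4) (fst.comp hm))) (snd.comp hm)

lemma primrec_valueAt {α : Type*} [Primcodable α] {l : α → List Mono} {v : α → Mono → Mono}
    {P : α → Mono} (hl : Primrec l) (hv : Primrec₂ v) (hP : Primrec P) :
    Primrec fun a => valueAt (l a) (v a) (P a) := by
  refine list_flatMap hl (list_map (list_range.comp (primrec_monoValue (hP.comp fst) snd)) ?_)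
  exact pair (Primrec.const true) (list_cons.comp (hv.comp (fst.comp fst) (snd.comp fst))
    (Primrec.const []))

lemma primrec_identityAt : Primrec fun a : ℕ × Mono => identityAt a.1 a.2 := by
  have h1 : Primrec fun a : ℕ × Mono => a.1 + 1 := succ.comp fst
  have hv : ∀ k, Primrec₂ fun (a : ℕ × Mono) (m : Mono) => unknown (a.1 + 1) k m := fun k =>
    primrec_unknown k (h1.comp fst) snd
  refine list_append.comp (SignedPoly.primrec_neg (primrec_valueAt (primrec_box fst)
    Primrec₂.right snd)) (list_append.comp (SignedPoly.primrec_mul ?_ ?_)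
      (SignedPoly.primrec_mul ?_ ?_))
  · exact primrec_valueAt (primrec_boxXY h1) (hv 0) snd
  · exact primrec_valueAt (primrec_box h1) (hv 2) snd
  · exact primrec_valueAt (primrec_boxZT h1) (hv 1) snd
  · exact primrec_valueAt (primrec_box h1) (hv 3) snd

lemma primrec_identityCell : Primrec identityCell :=
  list_map (primrec_box (nat_mul.comp (Primrec.const 2) succ))
    (pair primrec_identityAt (Primrec.const true))

lemma primrec_nonconstLiteral {α : Type*} [Primcodable α] {n : α → ℕ} (k : ℕ) {m : α → Mono}
    (hn : Primrec n) (hm : Primrec m) : Primrec fun a => nonconstLiteral (n a) k (m a) :=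
  pair (list_cons.comp (pair (Primrec.const true) (list_cons.comp (primrec_unknown k hn hm)
    (Primrec.const []))) (Primrec.const [])) (Primrec.const false)

lemma primrec_startFormula : Primrec startFormula := by
  refine list_flatMap (SignedPoly.primrec_without (Primrec.const _) (primrec_boxXY succ))
    (list_map (SignedPoly.primrec_without (Primrec.const _) (primrec_boxZT (succ.comp fst))) ?_)
  refine list_append.comp (primrec_identityCell.comp (fst.comp fst)) (list_cons.comp ?_
    (list_cons.comp ?_ (Primrec.const [])))
  · exact primrec_nonconstLiteral 0 (succ.comp (fst.comp fst)) (snd.comp fst)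
  · exact primrec_nonconstLiteral 1 (succ.comp (fst.comp fst)) snd

lemma primrec_unknowns : Primrec unknowns :=
  list_map (primrec_box (nat_add.comp (nat_mul.comp (Primrec.const 4) Primrec.id)
    (Primrec.const 3))) (pair (nat_add.comp fst (fst.comp snd)) (snd.comp snd))

lemma primrec_cartesianTests : Primrec cartesianTests := by
  refine list_map (SignedPoly.primrec_foldl_eliminate (primrec_unknowns.comp succ)
    primrec_startFormula) (list_map snd (pair (list_map (fst.comp snd) ?_) (snd.comp snd)))
  exact pair ((dom_bool fun b => bif b then (1 : ℤ) else -1).comp (fst.comp snd)) (snd.comp snd)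

end Primrec

lemma eval_toCoeffPoly (p : SignedPoly Mono) (F : MvPolynomial (Fin 4) ℂ) :
    CoeffPoly.eval (toCoeffPoly p) F = SignedPoly.eval (coeffAt F) p := by
  simp only [CoeffPoly.eval, toCoeffPoly, SignedPoly.eval, List.map_map]
  congr 1
  refine List.map_congr_left fun s _ => ?_
  rcases s with ⟨_ | _, l⟩ <;> simp

lemma accepts_cartesianTests_iff (d : ℕ) (F : MvPolynomial (Fin 4) ℂ) :
    (cartesianTests d).Accepts F ↔ ∃ ρ : Mono → ℂ,
      (∀ y, y ∉ unknowns (d + 1) → ρ y = coeffAt F y) ∧ SignedPoly.Holds (startFormula d) ρ := by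
  rw [← SignedPoly.holds_foldl_eliminate]
  simp only [ZeroTests.Accepts, cartesianTests, List.mem_map, exists_exists_and_eq_and,
    SignedPoly.Holds, SignedPoly.Cell.Holds]
  simp only [forall_exists_index, and_imp, forall_apply_eq_imp_iff₂, eval_toCoeffPoly]

lemma mem_box {n : ℕ} {m : Mono} :
    m ∈ box n ↔ m.1 ≤ n ∧ m.2.1 ≤ n ∧ m.2.2.1 ≤ n ∧ m.2.2.2 ≤ n := by
  obtain ⟨i, j, k, l⟩ := m
  simp [box]

lemma mem_boxXY {n : ℕ} {m : Mono} :
    m ∈ boxXY n ↔ m.1 ≤ n ∧ m.2.1 ≤ n ∧ m.2.2.1 = 0 ∧ m.2.2.2 = 0 := by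
  obtain ⟨i, j, k, l⟩ := m
  simp [boxXY, eq_comm]

lemma mem_boxZT {n : ℕ} {m : Mono} :
    m ∈ boxZT n ↔ m.1 = 0 ∧ m.2.1 = 0 ∧ m.2.2.1 ≤ n ∧ m.2.2.2 ≤ n := by
  obtain ⟨i, j, k, l⟩ := m
  simp only [boxZT, List.mem_flatMap, List.mem_map, List.mem_range, Prod.mk.injEq]
  constructor
  · rintro ⟨a, ha, b, hb, rfl, rfl, rfl, rfl⟩
    omega
  · rintro ⟨rfl, rfl, hk, hl⟩
    exact ⟨k, by omega, l, by omega, rfl, rfl, rfl, rfl⟩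

lemma mem_unknowns {n : ℕ} {y : Mono} :
    y ∈ unknowns n ↔ n ≤ y.1 ∧ y.1 ≤ n + (4 * n + 3) ∧ y.2.1 ≤ 4 * n + 3 ∧ y.2.2.1 ≤ 4 * n + 3 ∧
      y.2.2.2 ≤ 4 * n + 3 := by
  obtain ⟨i, j, k, l⟩ := y
  simp only [unknowns, List.mem_map, mem_box, Prod.mk.injEq, Prod.exists]
  constructor
  · rintro ⟨a, b, c, e, h, rfl, rfl, rfl, rfl⟩
    omega
  · intro h
    exact ⟨i - n, j, k, l, by omega, by omega, rfl, rfl, rfl⟩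

lemma unknown_mem_unknowns {n k : ℕ} (hk : k ≤ 3) {m : Mono} (hm : m ∈ box n) :
    unknown n k m ∈ unknowns n := by
  rw [mem_box] at hm
  rw [mem_unknowns]
  simp only [unknown]
  omega

lemma nodup_flatMap_of_key {α β : Type*} {l : List α} {f : α → List β} (g : β → α) (hl : l.Nodup)
    (hf : ∀ a, (f a).Nodup) (hg : ∀ a, ∀ b ∈ f a, g b = a) : (l.flatMap f).Nodup := by
  rw [List.nodup_flatMap]
  refine ⟨fun a _ => hf a, hl.imp fun {a a'} hne b hb hb' => hne ?_⟩
  rw [← hg a b hb, hg a' b hb']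

lemma nodup_box (n : ℕ) : (box n).Nodup := by
  have hr := List.nodup_range (n := n + 1)
  refine nodup_flatMap_of_key (fun m => m.1) hr (fun i => ?_) (by simp; intros; omega)
  refine nodup_flatMap_of_key (fun m => m.2.1) hr (fun j => ?_) (by simp; intros; omega)
  refine nodup_flatMap_of_key (fun m => m.2.2.1) hr (fun k => ?_) (by simp)
  exact hr.map fun l l' h => by simpa using h

lemma nodup_boxXY (n : ℕ) : (boxXY n).Nodup := by
  have hr := List.nodup_range (n := n + 1)
  refine nodup_flatMap_of_key (fun m => m.1) hr (fun i => ?_) (by simp)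
  exact hr.map fun l l' h => by simpa using h

lemma nodup_boxZT (n : ℕ) : (boxZT n).Nodup := by
  have hr := List.nodup_range (n := n + 1)
  refine nodup_flatMap_of_key (fun m => m.2.2.1) hr (fun i => ?_) (by simp)
  exact hr.map fun l l' h => by simpa using h

/-! ### Coefficient lists, polynomials and the correctness of the tests -/

noncomputable section

def expo (m : Mono) : Fin 4 →₀ ℕ :=
  Finsupp.equivFunOnFinite.symm ![m.1, m.2.1, m.2.2.1, m.2.2.2]

def toMono (e : Fin 4 →₀ ℕ) : Mono := (e 0, e 1, e 2, e 3)

lemma expo_toMono (e : Fin 4 →₀ ℕ) : expo (toMono e) = e := by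
  ext i; fin_cases i <;> rfl

lemma toMono_expo (m : Mono) : toMono (expo m) = m := rfl

lemma coeffAt_toMono (F : MvPolynomial (Fin 4) ℂ) (e : Fin 4 →₀ ℕ) :
    coeffAt F (toMono e) = F.coeff e := congrArg F.coeff (expo_toMono e)

def polyOf (l : List Mono) (c : Mono → ℂ) : MvPolynomial (Fin 4) ℂ :=
  (l.map fun m => monomial (expo m) (c m)).sum

lemma polyOf_congr {l : List Mono} {c c' : Mono → ℂ} (h : ∀ m ∈ l, c m = c' m) :
    polyOf l c = polyOf l c' := by
  rw [polyOf, polyOf, List.map_congr_left fun m hm => by rw [h m hm]]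

lemma coeffAt_polyOf {l : List Mono} (hl : l.Nodup) (c : Mono → ℂ) (m : Mono) :
    coeffAt (polyOf l c) m = if m ∈ l then c m else 0 := by
  have h : coeffAt (polyOf l c) m = ∑ m' ∈ l.toFinset, if m' = m then c m' else 0 := by
    rw [polyOf, ← List.sum_toFinset _ hl]
    change coeff (expo m) _ = _
    rw [coeff_sum]
    refine Finset.sum_congr rfl fun m' _ => ?_
    rw [coeff_monomial]
    refine if_congr ⟨fun h => ?_, fun h => by rw [h]⟩ rfl rfl
    rw [← toMono_expo m', h, toMono_expo]
  rw [h, Finset.sum_ite_eq']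
  simp

lemma polyOf_coeffAt {l : List Mono} (hl : l.Nodup) {F : MvPolynomial (Fin 4) ℂ}
    (h : ∀ m, coeffAt F m ≠ 0 → m ∈ l) : polyOf l (coeffAt F) = F := by
  ext e
  rw [← coeffAt_toMono, ← coeffAt_toMono, coeffAt_polyOf hl]
  split_ifs with hm
  · rfl
  · by_contra h0
    exact hm (h _ (Ne.symm h0))

def point (P : Mono) : Fin 4 → ℂ := ![(P.1 : ℂ), P.2.1, P.2.2.1, P.2.2.2]

/-- The integer value of a monomial at the point is encoded by repeating its term that many times.
-/
lemma eval_valueAt (l : List Mono) (v : Mono → Mono) (P : Mono) (ρ : Mono → ℂ) :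
    SignedPoly.eval ρ (valueAt l v P) = eval (point P) (polyOf l fun m => ρ (v m)) := by
  rw [valueAt, SignedPoly.eval_flatMap, polyOf, map_list_sum, List.map_map]
  congr 1
  refine List.map_congr_left fun m _ => ?_
  rw [Function.comp_apply, eval_monomial, Finsupp.prod_fintype _ _ (by simp)]
  simp [SignedPoly.eval, monoValue, Fin.prod_univ_four, point, expo, List.map_const', mul_comm]

lemma degreeOf_polyOf_le {l : List Mono} {n : ℕ} (hl : ∀ m ∈ l, m ∈ box n) (c : Mono → ℂ)
    (i : Fin 4) : (polyOf l c).degreeOf i ≤ n := by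
  induction l with
  | nil => simp [polyOf]
  | cons m l ih =>
    have h : polyOf (m :: l) c = monomial (expo m) (c m) + polyOf l c := by simp [polyOf]
    rw [h]
    refine (degreeOf_add_le _ _ _).trans (max_le ?_ (ih fun m hm => hl m (List.mem_cons_of_mem _ hm)))
    have hm := mem_box.mp (hl m List.mem_cons_self)
    by_cases h0 : c m = 0
    · simp [h0]
    · rw [degreeOf_monomial_eq _ _ h0]
      fin_cases i
      exacts [hm.1, hm.2.1, hm.2.2.1, hm.2.2.2]

lemma le_totalDegree_of_coeffAt_ne_zero {F : MvPolynomial (Fin 4) ℂ} {m : Mono}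
    (h : coeffAt F m ≠ 0) : m.1 + m.2.1 + m.2.2.1 + m.2.2.2 ≤ F.totalDegree := by
  have := le_totalDegree (mem_support_iff.mpr h)
  rwa [Finsupp.sum_fintype _ _ (by simp), Fin.sum_univ_four] at this

lemma mem_box_of_coeffAt_ne_zero {F : MvPolynomial (Fin 4) ℂ} {n : ℕ} (hF : F.totalDegree ≤ n)
    {m : Mono} (h : coeffAt F m ≠ 0) : m ∈ box n := by
  have := le_totalDegree_of_coeffAt_ne_zero h
  rw [mem_box]
  omega

lemma mem_boxXY_of_coeffAt_ne_zero {G : MvPolynomial (Fin 2) ℂ} {n : ℕ} (hG : G.totalDegree ≤ n)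
    {m : Mono} (h : coeffAt (rename placeXY G) m ≠ 0) : m ∈ boxXY n := by
  have h1 := mem_box.mp (mem_box_of_coeffAt_ne_zero ((totalDegree_rename_le _ _).trans hG) h)
  have h2 := fun {i} => apply_eq_zero_of_mem_support_rename (i := i) (mem_support_iff.mpr h)
  exact mem_boxXY.mpr ⟨h1.1, h1.2.1, h2 (i := 2) (by decide), h2 (i := 3) (by decide)⟩

lemma mem_boxZT_of_coeffAt_ne_zero {G : MvPolynomial (Fin 2) ℂ} {n : ℕ} (hG : G.totalDegree ≤ n)
    {m : Mono} (h : coeffAt (rename placeZT G) m ≠ 0) : m ∈ boxZT n := by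
  have h1 := mem_box.mp (mem_box_of_coeffAt_ne_zero ((totalDegree_rename_le _ _).trans hG) h)
  have h2 := fun {i} => apply_eq_zero_of_mem_support_rename (i := i) (mem_support_iff.mpr h)
  exact mem_boxZT.mpr ⟨h2 (i := 0) (by decide), h2 (i := 1) (by decide), h1.2.2.1, h1.2.2.2⟩

lemma exists_rename_eq_polyOf_boxXY (n : ℕ) (c : Mono → ℂ) :
    ∃ G : MvPolynomial (Fin 2) ℂ, rename placeXY G = polyOf (boxXY n) c := by
  rw [← AlgHom.mem_range, polyOf]
  refine list_sum_mem fun p hp => ?_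
  obtain ⟨m, hm, rfl⟩ := List.mem_map.mp hp
  obtain ⟨-, -, h2, h3⟩ := mem_boxXY.mp hm
  refine ⟨C (c m) * X 0 ^ m.1 * X 1 ^ m.2.1, ?_⟩
  rw [monomial_eq, Finsupp.prod_fintype _ _ (by simp), Fin.prod_univ_four]
  simp [expo, h2, h3, mul_assoc]

lemma exists_rename_eq_polyOf_boxZT (n : ℕ) (c : Mono → ℂ) :
    ∃ H : MvPolynomial (Fin 2) ℂ, rename placeZT H = polyOf (boxZT n) c := by
  rw [← AlgHom.mem_range, polyOf]
  refine list_sum_mem fun p hp => ?_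
  obtain ⟨m, hm, rfl⟩ := List.mem_map.mp hp
  obtain ⟨h0, h1, -, -⟩ := mem_boxZT.mp hm
  refine ⟨C (c m) * X 0 ^ m.2.2.1 * X 1 ^ m.2.2.2, ?_⟩
  rw [monomial_eq, Finsupp.prod_fintype _ _ (by simp), Fin.prod_univ_four]
  simp [expo, h0, h1, mul_assoc]

lemma exists_coeffAt_ne_zero {ι : Fin 2 → Fin 4} (hι : Function.Injective ι)
    {G : MvPolynomial (Fin 2) ℂ} (hG : ∀ c, G ≠ C c) :
    ∃ m : Mono, m ≠ (0, 0, 0, 0) ∧ coeffAt (rename ι G) m ≠ 0 := by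
  by_contra! hcon
  refine hG (coeffAt (rename ι G) (0, 0, 0, 0)) (rename_injective ι hι ?_)
  ext e
  rw [rename_C, coeff_C, ← expo_toMono e]
  split_ifs with h
  · have : toMono e = (0, 0, 0, 0) := by rw [← toMono_expo (toMono e), ← h]; rfl
    rw [this]; rfl
  · refine hcon (toMono e) fun h0 => h ?_
    rw [h0]; ext i; fin_cases i <;> rfl

lemma ne_C_of_coeffAt_ne_zero {ι : Fin 2 → Fin 4} {G : MvPolynomial (Fin 2) ℂ} {m : Mono}
    (hm : m ≠ (0, 0, 0, 0)) (h : coeffAt (rename ι G) m ≠ 0) (c : ℂ) : G ≠ C c := by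
  rintro rfl
  refine h ?_
  rw [rename_C]
  change coeff (expo m) _ = 0
  rw [coeff_C, if_neg]
  intro h0
  exact hm (by rw [← toMono_expo m, ← h0]; rfl)

lemma eq_of_eval_point_eq {p q : MvPolynomial (Fin 4) ℂ} {n : ℕ}
    (hp : ∀ i, (p - q).degreeOf i ≤ n)
    (h : ∀ P ∈ box n, eval (point P) p = eval (point P) q) : p = q := by
  classical
  rw [← sub_eq_zero]
  refine eq_zero_of_eval_zero_at_prod_finset _
    (fun _ => (Finset.range (n + 1)).image fun k : ℕ => (k : ℂ)) (fun i => ?_) fun x hx => ?_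
  · rw [Finset.card_image_of_injective _ Nat.cast_injective, Finset.card_range]
    exact Nat.lt_succ_of_le (hp i)
  · simp only [Finset.mem_image, Finset.mem_range] at hx
    choose k hk hkx using hx
    have : x = point (k 0, k 1, k 2, k 3) := by
      funext i; rw [← hkx]; fin_cases i <;> rfl
    rw [this, map_sub, sub_eq_zero]
    refine h _ (mem_box.mpr ⟨?_, ?_, ?_, ?_⟩) <;> exact Nat.lt_succ_iff.mp (hk _)

lemma mem_without {x m : Mono} {l : List Mono} :
    m ∈ SignedPoly.without x l ↔ m ∈ l ∧ m ≠ x := by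
  simp only [SignedPoly.without, List.mem_flatMap]
  constructor
  · rintro ⟨y, hy, h⟩
    split_ifs at h with hyx
    · simp at h
    · rw [List.mem_singleton] at h
      exact h ▸ ⟨hy, hyx⟩
  · rintro ⟨h, h'⟩
    exact ⟨m, h, by simp [h']⟩

lemma boxXY_subset_box {n : ℕ} {m : Mono} (h : m ∈ boxXY n) : m ∈ box n := by
  rw [mem_boxXY] at h; rw [mem_box]; omega

lemma boxZT_subset_box {n : ℕ} {m : Mono} (h : m ∈ boxZT n) : m ∈ box n := by
  rw [mem_boxZT] at h; rw [mem_box]; omega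

lemma eval_identityAt (d : ℕ) (P : Mono) (ρ : Mono → ℂ) :
    SignedPoly.eval ρ (identityAt d P) = 0 ↔
      eval (point P) (polyOf (box d) ρ) = eval (point P)
        (polyOf (boxXY (d + 1)) (fun m => ρ (unknown (d + 1) 0 m)) *
            polyOf (box (d + 1)) (fun m => ρ (unknown (d + 1) 2 m)) +
          polyOf (boxZT (d + 1)) (fun m => ρ (unknown (d + 1) 1 m)) *
            polyOf (box (d + 1)) (fun m => ρ (unknown (d + 1) 3 m))) := by
  simp only [identityAt, SignedPoly.eval_append, SignedPoly.eval_neg, SignedPoly.eval_mul,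
    eval_valueAt, map_add, map_mul]
  rw [neg_add_eq_zero]

lemma holds_startFormula (d : ℕ) (ρ : Mono → ℂ) :
    SignedPoly.Holds (startFormula d) ρ ↔
      (∃ m ∈ boxXY (d + 1), m ≠ (0, 0, 0, 0) ∧ ρ (unknown (d + 1) 0 m) ≠ 0) ∧
      (∃ m ∈ boxZT (d + 1), m ≠ (0, 0, 0, 0) ∧ ρ (unknown (d + 1) 1 m) ≠ 0) ∧
      ∀ P ∈ box (2 * (d + 1)), SignedPoly.eval ρ (identityAt d P) = 0 := by
  have hid : SignedPoly.Cell.Holds (identityCell d) ρ ↔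
      ∀ P ∈ box (2 * (d + 1)), SignedPoly.eval ρ (identityAt d P) = 0 := by
    simp only [SignedPoly.Cell.Holds, identityCell, List.mem_map, forall_exists_index, and_imp,
      forall_apply_eq_imp_iff₂, true_iff]
  have hne : ∀ m m' : Mono, SignedPoly.Cell.Holds
      [nonconstLiteral (d + 1) 0 m, nonconstLiteral (d + 1) 1 m'] ρ ↔
      ρ (unknown (d + 1) 0 m) ≠ 0 ∧ ρ (unknown (d + 1) 1 m') ≠ 0 := by
    intro m m'
    simp [SignedPoly.Cell.Holds, nonconstLiteral]
  simp only [SignedPoly.Holds, startFormula, List.mem_flatMap, List.mem_map, mem_without]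
  constructor
  · rintro ⟨_, ⟨m, hm, m', hm', rfl⟩, h⟩
    rw [SignedPoly.Cell.holds_append, hid, hne] at h
    exact ⟨⟨m, hm.1, hm.2, h.2.1⟩, ⟨m', hm'.1, hm'.2, h.2.2⟩, h.1⟩
  · rintro ⟨⟨m, hm, hm0, h⟩, ⟨m', hm', hm0', h'⟩, hP⟩
    refine ⟨_, ⟨m, ⟨hm, hm0⟩, m', ⟨hm', hm0'⟩, rfl⟩, ?_⟩
    rw [SignedPoly.Cell.holds_append, hid, hne]
    exact ⟨hP, h, h'⟩

/-- The bound is `d + 1` rather than `d` because `F = 0` with `d = 0` still needs non-constant `G`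
and `H`. -/
lemma IsCartesian.exists_totalDegree_le {F : MvPolynomial (Fin 4) ℂ} {d : ℕ}
    (hd : F.totalDegree ≤ d) (hF : IsCartesian F) :
    ∃ (G H : MvPolynomial (Fin 2) ℂ) (F₁ F₂ : MvPolynomial (Fin 4) ℂ),
      (∀ c, G ≠ C c) ∧ (∀ c, H ≠ C c) ∧ G.totalDegree ≤ d + 1 ∧ H.totalDegree ≤ d + 1 ∧
      F₁.totalDegree ≤ d + 1 ∧ F₂.totalDegree ≤ d + 1 ∧
      F = rename placeXY G * F₁ + rename placeZT H * F₂ := by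
  have hnc : ∀ {P : MvPolynomial (Fin 2) ℂ}, Irreducible P → ∀ c, P ≠ C c := by
    rintro P hP c rfl
    simpa using one_le_totalDegree_of_irreducible hP
  by_cases hF0 : F = 0
  · exact ⟨X 0, X 0, 0, 0, hnc irreducible_X_zero, hnc irreducible_X_zero, by simp, by simp,
      by simp, by simp, by simp [hF0]⟩
  · obtain ⟨G, H, F₁, F₂, hG, hH, hGd, hHd, hFe, h₁, h₂⟩ := hF.exists_irreducible hF0
    have hle : ∀ {κ : Fin 2 → Fin 4}, Function.Injective κ → ∀ {P : MvPolynomial (Fin 2) ℂ}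
        {E : MvPolynomial (Fin 4) ℂ}, Irreducible P →
        (rename κ P * E).totalDegree ≤ F.totalDegree → E.totalDegree ≤ d + 1 := by
      intro κ hκ P E hP hPE
      by_cases hE0 : E = 0
      · simp [hE0]
      have hP0 := (rename_injective _ hκ).ne_iff' (map_zero _) |>.mpr hP.ne_zero
      rw [totalDegree_mul_of_isDomain hP0 hE0] at hPE
      omega
    exact ⟨G, H, F₁, F₂, hnc hG, hnc hH, by omega, by omega, hle placeXY_injective hG h₁,
      hle placeZT_injective hH h₂, hFe⟩

theorem isCartesian_iff_accepts {F : MvPolynomial (Fin 4) ℂ} {d : ℕ} (hd : F.totalDegree ≤ d) :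
    IsCartesian F ↔ (cartesianTests d).Accepts F := by
  have hFpoly : polyOf (box d) (coeffAt F) = F :=
    polyOf_coeffAt (nodup_box d) fun m => mem_box_of_coeffAt_ne_zero hd
  -- Coefficients of `F` have first entry at most `d`, unknowns at least `d + 1`, so the elimination
  -- never touches the input.
  have hnot : ∀ m ∈ box d, m ∉ unknowns (d + 1) := by
    intro m hm h
    rw [mem_box] at hm
    rw [mem_unknowns] at h
    omega
  simp only [accepts_cartesianTests_iff, holds_startFormula, eval_identityAt]
  constructor
  · intro hF
    obtain ⟨G, H, F₁, F₂, hG, hH, hGd, hHd, h₁, h₂, hFe⟩ := hF.exists_totalDegree_le hd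
    let sel : ℕ → MvPolynomial (Fin 4) ℂ := fun k =>
      if k = 0 then rename placeXY G else if k = 1 then rename placeZT H else
        if k = 2 then F₁ else F₂
    -- Decodes `unknown`: after the shift is removed, the residue modulo 4 selects the polynomial
    -- and the quotient is the exponent of `x`.
    let ρ : Mono → ℂ := fun y => if y ∈ unknowns (d + 1) then
      coeffAt (sel ((y.1 - (d + 1)) % 4)) ((y.1 - (d + 1)) / 4, y.2) else coeffAt F y
    have hρ : ∀ k ≤ 3, ∀ m ∈ box (d + 1), ρ (unknown (d + 1) k m) = coeffAt (sel k) m := by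
      intro k hk m hm
      simp only [ρ, if_pos (unknown_mem_unknowns hk hm)]
      have h4 : (unknown (d + 1) k m).1 - (d + 1) = k + 4 * m.1 := by simp only [unknown]; omega
      rw [h4, Nat.add_mul_mod_self_left, Nat.mod_eq_of_lt (by omega),
        Nat.add_mul_div_left _ _ (by omega), Nat.div_eq_of_lt (by omega), zero_add]
      rfl
    have hpoly : ∀ k ≤ 3, ∀ l : List Mono, l.Nodup → (∀ m ∈ l, m ∈ box (d + 1)) →
        (∀ m, coeffAt (sel k) m ≠ 0 → m ∈ l) →
        polyOf l (fun m => ρ (unknown (d + 1) k m)) = sel k := by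
      intro k hk l hl hlb hls
      rw [polyOf_congr fun m hm => hρ k hk m (hlb m hm)]
      exact polyOf_coeffAt hl hls
    refine ⟨ρ, fun y hy => if_neg hy, ?_, ?_, fun P _ => ?_⟩
    · obtain ⟨m, hm, h⟩ := exists_coeffAt_ne_zero placeXY_injective hG
      have hmem := mem_boxXY_of_coeffAt_ne_zero hGd h
      exact ⟨m, hmem, hm, by rwa [hρ 0 (by omega) m (boxXY_subset_box hmem)]⟩
    · obtain ⟨m, hm, h⟩ := exists_coeffAt_ne_zero placeZT_injective hH
      have hmem := mem_boxZT_of_coeffAt_ne_zero hHd h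
      exact ⟨m, hmem, hm, by rwa [hρ 1 (by omega) m (boxZT_subset_box hmem)]⟩
    · rw [polyOf_congr (c' := coeffAt F) fun m hm => if_neg (hnot m hm), hFpoly,
        hpoly 0 (by omega) _ (nodup_boxXY _) (fun _ => boxXY_subset_box)
          (fun _ => mem_boxXY_of_coeffAt_ne_zero hGd),
        hpoly 1 (by omega) _ (nodup_boxZT _) (fun _ => boxZT_subset_box)
          (fun _ => mem_boxZT_of_coeffAt_ne_zero hHd),
        hpoly 2 (by omega) _ (nodup_box _) (fun _ h => h)
          (fun _ => mem_box_of_coeffAt_ne_zero h₁),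
        hpoly 3 (by omega) _ (nodup_box _) (fun _ h => h)
          (fun _ => mem_box_of_coeffAt_ne_zero h₂)]
      exact congrArg _ hFe
  · rintro ⟨ρ, hρ, ⟨m, hm, hm0, h⟩, ⟨m', hm', hm0', h'⟩, hP⟩
    rw [polyOf_congr (c' := coeffAt F) fun m hm => hρ m (hnot m hm), hFpoly] at hP
    obtain ⟨G, hG⟩ := exists_rename_eq_polyOf_boxXY (d + 1) fun m => ρ (unknown (d + 1) 0 m)
    obtain ⟨H, hH⟩ := exists_rename_eq_polyOf_boxZT (d + 1) fun m => ρ (unknown (d + 1) 1 m)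
    refine ⟨G, H, ne_C_of_coeffAt_ne_zero (ι := placeXY) hm0 ?_,
      ne_C_of_coeffAt_ne_zero (ι := placeZT) hm0' ?_,
      polyOf (box (d + 1)) fun m => ρ (unknown (d + 1) 2 m),
      polyOf (box (d + 1)) fun m => ρ (unknown (d + 1) 3 m), ?_⟩
    · rwa [hG, coeffAt_polyOf (nodup_boxXY _), if_pos hm]
    · rwa [hH, coeffAt_polyOf (nodup_boxZT _), if_pos hm']
    · change F = rename placeXY G * _ + rename placeZT H * _
      rw [hG, hH]
      refine eq_of_eval_point_eq (fun i => ?_) hP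
      have hmul : ∀ {l : List Mono} (c c' : Mono → ℂ), (∀ m ∈ l, m ∈ box (d + 1)) →
          (polyOf l c * polyOf (box (d + 1)) c').degreeOf i ≤ 2 * (d + 1) := by
        intro l c c' hl
        refine (degreeOf_mul_le _ _ _).trans ?_
        have h1 := degreeOf_polyOf_le hl c i
        have h2 := degreeOf_polyOf_le (l := box (d + 1)) (fun _ h => h) c' i
        omega
      rw [sub_eq_add_neg]
      refine (degreeOf_add_le _ _ _).trans (max_le ?_ ?_)
      · exact (degreeOf_le_totalDegree _ _).trans (by omega)
      · rw [degreeOf_neg]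
        exact (degreeOf_add_le _ _ _).trans (max_le (hmul _ _ fun _ => boxXY_subset_box)
          (hmul _ _ fun _ => boxZT_subset_box))

end

end CartesianPoly

/-! ### The weak Nullstellensatz and Gröbner bases -/

namespace MvPolynomial

lemma span_ne_top_iff_exists_eval_eq_zero {σ K : Type*} [Finite σ] [Field K] [IsAlgClosed K]
    (S : Set (MvPolynomial σ K)) :
    Ideal.span S ≠ ⊤ ↔ ∃ a : σ → K, ∀ p ∈ S, eval a p = 0 := by
  constructor
  · intro h
    by_contra! hcon
    refine h (Ideal.radical_eq_top.mp ?_)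
    rw [← vanishingIdeal_zeroLocus_eq_radical (K := K), zeroLocus_span]
    convert vanishingIdeal_empty
    ext a
    obtain ⟨p, hp, hpa⟩ := hcon a
    simp only [Set.mem_ofPred_eq, Set.mem_empty_iff_false, iff_false, not_forall]
    exact ⟨p, hp, by simpa [aeval_eq_eval] using hpa⟩
  · rintro ⟨a, ha⟩ h
    have h1 : Ideal.span S ≤ RingHom.ker (eval a) := Ideal.span_le.mpr fun p hp => ha p hp
    have h2 : (1 : MvPolynomial σ K) ∈ RingHom.ker (eval a) := h1 (h ▸ Submodule.mem_top)
    simp [RingHom.mem_ker] at h2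

end MvPolynomial

namespace CartesianPoly

section Groebner

variable {σ : Type*} (m : MonomialOrder σ) (I : Ideal (MvPolynomial σ ℂ))

/-- By noetherianity, the ideal of leading terms is already generated by finitely many of these
leading terms. -/
lemma exists_isGroebnerBasis [Finite σ] : ∃ B, IsGroebnerBasis m I B := by
  classical
  obtain ⟨s, hs, hspan⟩ := (Submodule.fg_span_iff_fg_span_finset_subset
    (R := MvPolynomial σ ℂ)
    (m.leadingTerm '' (I : Set (MvPolynomial σ ℂ)))).mp (IsNoetherian.noetherian _)
  obtain ⟨B, hB, rfl⟩ := Finset.subset_set_image_iff.mp hs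
  exact ⟨B, hB, by rw [Ideal.span, hspan, Finset.coe_image]⟩

variable {m I}

/-- If `1` lies in the ideal of leading terms, these cannot all have zero constant coefficient; but
a leading term with nonzero constant coefficient has degree zero, so its polynomial is a constant.
-/
lemma IsGroebnerBasis.eq_top_iff {B : Finset (MvPolynomial σ ℂ)} (hB : IsGroebnerBasis m I B) :
    I = ⊤ ↔ ∃ c : ℂ, c ≠ 0 ∧ C c ∈ B := by
  classical
  constructor
  · rintro rfl
    have h1 : (1 : MvPolynomial σ ℂ) ∈ Ideal.span (m.leadingTerm '' (B : Set (MvPolynomial σ ℂ))) := by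
      rw [← hB.2]
      refine Ideal.subset_span ⟨1, Submodule.mem_top, ?_⟩
      rw [← C_1, m.leadingTerm_C]
    by_contra! hcon
    have h2 : Ideal.span (m.leadingTerm '' (B : Set (MvPolynomial σ ℂ))) ≤
        RingHom.ker (constantCoeff : MvPolynomial σ ℂ →+* ℂ) := by
      rw [Ideal.span_le]
      rintro _ ⟨b, hb, rfl⟩
      rw [SetLike.mem_coe, RingHom.mem_ker, MonomialOrder.leadingTerm, constantCoeff_monomial]
      split_ifs with h0
      · have hbC := m.eq_C_of_degree_eq_zero h0
        by_contra hne
        exact hcon _ hne (by rwa [← hbC])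
      · rfl
    simpa [RingHom.mem_ker] using h2 h1
  · rintro ⟨c, hc, hcB⟩
    exact Ideal.eq_top_of_isUnit_mem _ (hB.1 _ hcB) ((isUnit_iff_ne_zero.mpr hc).map C)

end Groebner

/-! ### Certificates -/

section Certificates

variable {F : MvPolynomial (Fin 4) ℂ} {G H : MvPolynomial (Fin 2) ℂ}

/-- At a common zero of `G` and `H` where `F` does not vanish, setting `u` to the inverse of the
value of `F` turns the identity into `0 = 1`. -/
lemma isCartesian_of_identity (hG : ∀ c, G ≠ C c) (hH : ∀ c, H ≠ C c)
    {q q₁ q₂ : MvPolynomial (Fin 5) ℂ}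
    (h : q * rab F + q₁ * inXY G + q₂ * inZT H = 1) : IsCartesian F := by
  refine isCartesian_of_vanishing hG hH fun P hPG hPH => ?_
  by_contra hPF
  let Q : Fin 5 → ℂ := Fin.snoc (α := fun _ => ℂ) P (eval P F)⁻¹
  have hQF : eval Q (rename Fin.castSucc F) = eval P F := by
    rw [eval_rename]
    congr 2
    funext i
    simp [Q]
  have hQG : eval Q (inXY G) = 0 := by
    rw [inXY, eval_rename, ← hPG]
    congr 2
    funext i; fin_cases i <;> rfl
  have hQH : eval Q (inZT H) = 0 := by
    rw [inZT, eval_rename, ← hPH]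
    congr 2
    funext i; fin_cases i <;> rfl
  have hQ4 : Q 4 = (eval P F)⁻¹ := Fin.snoc_last (α := fun _ => ℂ) _ _
  have h1 := congrArg (eval Q) h
  simp only [map_add, map_mul, hQG, hQH, rab, map_sub, map_one, eval_X, hQF, hQ4,
    inv_mul_cancel₀ hPF, sub_self, mul_zero, add_zero] at h1
  exact zero_ne_one h1

lemma ne_C_of_one_le_totalDegree (hG : 1 ≤ G.totalDegree) (c : ℂ) : G ≠ C c := by
  rintro rfl
  simp at hG

lemma IsCertificate.isCartesian {d N : ℕ} {q q₁ q₂ : MvPolynomial (Fin 5) ℂ}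
    (h : IsCertificate d N F G H q q₁ q₂) : IsCartesian F :=
  isCartesian_of_identity (ne_C_of_one_le_totalDegree h.one_le_degree_G)
    (ne_C_of_one_le_totalDegree h.one_le_degree_H) h.identity

lemma totalDegree_X_mul_rename_le (E : MvPolynomial (Fin 4) ℂ) :
    (X 4 * rename Fin.castSucc E : MvPolynomial (Fin 5) ℂ).totalDegree ≤ E.totalDegree + 1 := by
  refine (totalDegree_mul _ _).trans ?_
  rw [totalDegree_X, add_comm]
  exact Nat.add_le_add_right (totalDegree_rename_le _ _) 1

lemma rename_castSucc_placeXY (G : MvPolynomial (Fin 2) ℂ) :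
    rename Fin.castSucc (rename placeXY G) = inXY G := by
  rw [rename_rename, inXY]
  congr 2
  funext i; fin_cases i <;> rfl

lemma rename_castSucc_placeZT (H : MvPolynomial (Fin 2) ℂ) :
    rename Fin.castSucc (rename placeZT H) = inZT H := by
  rw [rename_rename, inZT]
  congr 2
  funext i; fin_cases i <;> rfl

lemma IsCartesian.exists_isCertificate (hF : IsCartesian F) (hF0 : F ≠ 0) {N : ℕ}
    (hN : F.totalDegree + 1 ≤ N) :
    ∃ (G H : MvPolynomial (Fin 2) ℂ) (q q₁ q₂ : MvPolynomial (Fin 5) ℂ),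
      IsCertificate F.totalDegree N F G H q q₁ q₂ := by
  obtain ⟨G, H, F₁, F₂, hG, hH, hGd, hHd, hFe, h₁, h₂⟩ := hF.exists_irreducible hF0
  have e₁ : X 4 * rename Fin.castSucc F₁ * inXY G =
      X 4 * rename Fin.castSucc (rename placeXY G * F₁) := by
    rw [map_mul, rename_castSucc_placeXY]; ring
  have e₂ : X 4 * rename Fin.castSucc F₂ * inZT H =
      X 4 * rename Fin.castSucc (rename placeZT H * F₂) := by
    rw [map_mul, rename_castSucc_placeZT]; ring
  -- The certificate is `(1 - u F) + u F₁ G + u F₂ H = 1`; the multiplication by `u` accounts for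
  -- the degree `F.totalDegree + 1`.
  refine ⟨G, H, 1, X 4 * rename Fin.castSucc F₁, X 4 * rename Fin.castSucc F₂, hG, hH, ?_,
    one_le_totalDegree_of_irreducible hG, hGd, one_le_totalDegree_of_irreducible hH, hHd, ?_, ?_, ?_⟩
  · have : rename Fin.castSucc F = (rename Fin.castSucc (rename placeXY G * F₁) +
        rename Fin.castSucc (rename placeZT H * F₂) : MvPolynomial (Fin 5) ℂ) := by
      rw [← map_add, ← hFe]
    rw [e₁, e₂, rab, this]
    ring
  · rw [one_mul, rab]
    refine (totalDegree_sub _ _).trans (max_le (by simp) ((totalDegree_X_mul_rename_le F).trans hN))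
  · rw [e₁]
    exact (totalDegree_X_mul_rename_le _).trans (by omega)
  · rw [e₂]
    exact (totalDegree_X_mul_rename_le _).trans (by omega)

lemma succ_le_bound (d : ℕ) : d + 1 ≤ bound d := by
  rw [bound]
  rcases Nat.eq_zero_or_pos d with rfl | hd
  · simp
  · exact le_max_of_le_left (Nat.le_mul_of_pos_right _ (by positivity))

end Certificates

/-! ### The system of equations -/

section System

lemma Expo.toFinsupp_injective {n D : ℕ} : Function.Injective (Expo.toFinsupp (n := n) (D := D)) := by
  intro e e' h
  refine Subtype.ext (funext fun i => Fin.ext ?_)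
  exact DFunLike.congr_fun h i

lemma Expo.exists_toFinsupp_eq {n D : ℕ} {u : Fin n →₀ ℕ} (hu : ∑ i, u i ≤ D) :
    ∃ e : Expo n D, e.toFinsupp = u := by
  have h : ∀ i, u i < D + 1 := fun i =>
    Nat.lt_succ_of_le ((Finset.single_le_sum (fun _ _ => Nat.zero_le _) (Finset.mem_univ i)).trans hu)
  exact ⟨⟨fun i => ⟨u i, h i⟩, hu⟩, by ext; rfl⟩

/-- The polynomial of degree at most `D` with given coefficients. -/
noncomputable def ofCoeffs {n D : ℕ} (c : Expo n D → ℂ) : MvPolynomial (Fin n) ℂ :=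
  ∑ e, monomial e.toFinsupp (c e)

lemma coeff_ofCoeffs {n D : ℕ} (c : Expo n D → ℂ) (e : Expo n D) :
    (ofCoeffs c).coeff e.toFinsupp = c e := by
  classical
  simp [ofCoeffs, coeff_sum, coeff_monomial, Expo.toFinsupp_injective.eq_iff]

lemma ofCoeffs_coeff {n D : ℕ} {p : MvPolynomial (Fin n) ℂ} (hp : p.totalDegree ≤ D) :
    ofCoeffs (fun e : Expo n D => p.coeff e.toFinsupp) = p := by
  classical
  ext u
  by_cases hu : ∑ i, u i ≤ D
  · obtain ⟨e, rfl⟩ := Expo.exists_toFinsupp_eq hu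
    rw [coeff_ofCoeffs]
  · have h0 : p.coeff u = 0 := by
      by_contra h
      have := le_totalDegree (mem_support_iff.mpr h)
      rw [Finsupp.sum_fintype _ _ (by simp)] at this
      exact hu (this.trans hp)
    rw [h0, ofCoeffs, coeff_sum]
    refine Finset.sum_eq_zero fun e _ => ?_
    rw [coeff_monomial, if_neg]
    rintro rfl
    exact hu e.2

variable {d N : ℕ}

lemma map_generic₂ (a : Unknown d N → ℂ) (k : Fin 4) :
    map (eval a) (generic₂ d N k) = ofCoeffs fun e => a (Sum.inl (k, e)) := by
  simp [generic₂, ofCoeffs, map_monomial]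

lemma map_generic₅ (a : Unknown d N → ℂ) (k : Fin 3) :
    map (eval a) (generic₅ d N k) = ofCoeffs fun e => a (Sum.inr (k, e)) := by
  simp [generic₅, ofCoeffs, map_monomial]

lemma map_rab {R S : Type*} [CommRing R] [CommRing S] (f : R →+* S) (F : MvPolynomial (Fin 4) R) :
    map f (rab F) = rab (map f F) := by
  simp [rab, map_rename]

lemma map_genericIdentity (a : Unknown d N → ℂ) (F : MvPolynomial (Fin 4) ℂ) :
    map (eval a) (genericIdentity d N F) =
      ofCoeffs (fun e => a (Sum.inr (0, e))) * rab F +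
      ofCoeffs (fun e => a (Sum.inr (1, e))) * inXY (ofCoeffs fun e => a (Sum.inl (0, e))) +
      ofCoeffs (fun e => a (Sum.inr (2, e))) * inZT (ofCoeffs fun e => a (Sum.inl (1, e))) - 1 := by
  have hF : map (eval a) (map C F) = F := by
    rw [map_map]
    have : (eval a).comp C = RingHom.id ℂ := by ext; simp
    rw [this, map_id]
  simp only [genericIdentity, inXY, inZT, map_sub, map_add, map_mul, map_one, map_rename,
    map_generic₂, map_generic₅, map_rab, hF]

lemma eval_nonconstEq (a : Unknown d N → ℂ) (k l : Fin 4) :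
    eval a (nonconstEq d N k l) = 0 ↔
      ∑ e : Expo 2 d with e.toFinsupp ≠ 0, a (Sum.inl (l, e)) * a (Sum.inl (k, e)) = 1 := by
  simp [nonconstEq, sub_eq_zero]

lemma system_vanishes_iff (a : Unknown d N → ℂ) (F : MvPolynomial (Fin 4) ℂ) :
    (∀ p ∈ system d N F, eval a p = 0) ↔
      map (eval a) (genericIdentity d N F) = 0 ∧ eval a (nonconstEq d N 0 2) = 0 ∧
        eval a (nonconstEq d N 1 3) = 0 := by
  classical
  have h : (∀ p ∈ (genericIdentity d N F).coeffs, eval a p = 0) ↔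
      map (eval a) (genericIdentity d N F) = 0 := by
    constructor
    · intro h
      ext u
      rw [coeff_map, coeff_zero]
      by_cases hu : (genericIdentity d N F).coeff u = 0
      · rw [hu, map_zero]
      · exact h _ (mem_coeffs_iff.mpr ⟨u, mem_support_iff.mpr hu, rfl⟩)
    · intro h p hp
      obtain ⟨u, -, rfl⟩ := mem_coeffs_iff.mp hp
      rw [← coeff_map, h, coeff_zero]
  rw [← h]
  simp only [system, Finset.mem_union, or_imp, forall_and, Finset.mem_insert, Finset.mem_singleton,
    forall_eq]

lemma ofCoeffs_ne_C_of_sum_eq_one {c w : Expo 2 d → ℂ}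
    (h : ∑ e : Expo 2 d with e.toFinsupp ≠ 0, w e * c e = 1) (b : ℂ) : ofCoeffs c ≠ C b := by
  classical
  intro hb
  refine zero_ne_one (h ▸ (Finset.sum_eq_zero fun e he => ?_).symm)
  rw [← coeff_ofCoeffs c e, hb, coeff_C, if_neg (Finset.mem_filter.mp he).2.symm, mul_zero]

lemma exists_sum_eq_one {G : MvPolynomial (Fin 2) ℂ} (hG : 1 ≤ G.totalDegree)
    (hGd : G.totalDegree ≤ d) : ∃ w : Expo 2 d → ℂ,
      ∑ e : Expo 2 d with e.toFinsupp ≠ 0, w e * G.coeff e.toFinsupp = 1 := by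
  classical
  obtain ⟨e, he, h⟩ : ∃ e : Expo 2 d, e.toFinsupp ≠ 0 ∧ G.coeff e.toFinsupp ≠ 0 := by
    by_contra! hcon
    refine ne_C_of_one_le_totalDegree hG (G.coeff 0) ?_
    rw [← ofCoeffs_coeff hGd]
    ext u
    by_cases hu : ∃ e : Expo 2 d, e.toFinsupp = u
    · obtain ⟨e, rfl⟩ := hu
      rw [coeff_ofCoeffs, coeff_C]
      split_ifs with h0
      · rw [← h0, ofCoeffs_coeff hGd]
      · exact hcon e (Ne.symm h0)
    · rw [coeff_C, if_neg]
      · rw [ofCoeffs, coeff_sum]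
        exact Finset.sum_eq_zero fun e _ => by rw [coeff_monomial, if_neg fun h => hu ⟨e, h⟩]
      · rintro rfl
        exact hu (Expo.exists_toFinsupp_eq (by simp))
  refine ⟨fun e' => if e' = e then (G.coeff e.toFinsupp)⁻¹ else 0, ?_⟩
  rw [Finset.sum_eq_single_of_mem e (by simpa using he)]
  · simp [h]
  · intro e' _ hne
    simp [hne]

/-- Certificates bound the products, while the unknowns of the system describe the factors `q`,
`q₁`, `q₂`. -/
lemma totalDegree_le_of_mul {σ : Type*} {p r : MvPolynomial σ ℂ} (hr : r ≠ 0)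
    (h : (p * r).totalDegree ≤ N) : p.totalDegree ≤ N := by
  by_cases hp : p = 0
  · simp [hp]
  · rw [totalDegree_mul_of_isDomain hp hr] at h
    omega

lemma rab_ne_zero (F : MvPolynomial (Fin 4) ℂ) : rab F ≠ 0 := by
  intro h
  simpa [rab] using congrArg (eval (0 : Fin 5 → ℂ)) h

/-- A certificate supplies the coefficients of a solution. Conversely, a solution need not have
irreducible `G` and `H`: non-constancy suffices for `isCartesian_of_identity`. -/
lemma isCartesian_iff_exists_solution {F : MvPolynomial (Fin 4) ℂ} (hF0 : F ≠ 0)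
    (hN : F.totalDegree + 1 ≤ N) :
    IsCartesian F ↔ ∃ a : Unknown F.totalDegree N → ℂ,
      ∀ p ∈ system F.totalDegree N F, eval a p = 0 := by
  simp only [system_vanishes_iff, map_genericIdentity, eval_nonconstEq, sub_eq_zero]
  constructor
  · intro hF
    obtain ⟨G, H, q, q₁, q₂, h⟩ := hF.exists_isCertificate hF0 hN
    obtain ⟨v, hv⟩ := exists_sum_eq_one h.one_le_degree_G h.degree_G_le
    obtain ⟨w, hw⟩ := exists_sum_eq_one h.one_le_degree_H h.degree_H_le
    have hG0 : inXY G ≠ 0 := by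
      refine (rename_injective _ (by decide)).ne_iff' (map_zero _) |>.mpr h.irreducible_G.ne_zero
    have hH0 : inZT H ≠ 0 := by
      refine (rename_injective _ (by decide)).ne_iff' (map_zero _) |>.mpr h.irreducible_H.ne_zero
    let a : Unknown F.totalDegree N → ℂ := Sum.elim
      (fun s => (![fun e => G.coeff e.toFinsupp, fun e => H.coeff e.toFinsupp, v, w] :
        Fin 4 → Expo 2 F.totalDegree → ℂ) s.1 s.2)
      (fun s => (![fun e => q.coeff e.toFinsupp, fun e => q₁.coeff e.toFinsupp,
        fun e => q₂.coeff e.toFinsupp] : Fin 3 → Expo 5 N → ℂ) s.1 s.2)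
    refine ⟨a, ?_, hv, hw⟩
    have e1 : ofCoeffs (fun e => a (Sum.inl (0, e))) = G := ofCoeffs_coeff h.degree_G_le
    have e2 : ofCoeffs (fun e => a (Sum.inl (1, e))) = H := ofCoeffs_coeff h.degree_H_le
    have e3 : ofCoeffs (fun e => a (Sum.inr (0, e))) = q :=
      ofCoeffs_coeff (totalDegree_le_of_mul (rab_ne_zero F) h.degree_le)
    have e4 : ofCoeffs (fun e => a (Sum.inr (1, e))) = q₁ :=
      ofCoeffs_coeff (totalDegree_le_of_mul hG0 h.degree_le₁)
    have e5 : ofCoeffs (fun e => a (Sum.inr (2, e))) = q₂ :=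
      ofCoeffs_coeff (totalDegree_le_of_mul hH0 h.degree_le₂)
    rw [e1, e2, e3, e4, e5]
    exact h.identity
  · rintro ⟨a, h, hv, hw⟩
    exact isCartesian_of_identity (ofCoeffs_ne_C_of_sum_eq_one hv)
      (ofCoeffs_ne_C_of_sum_eq_one hw) h

/-- All coefficients have degree at most `k`. -/
def CoeffDegreeLE {σ τ : Type*} (k : ℕ) (p : MvPolynomial σ (MvPolynomial τ ℂ)) : Prop :=
  ∀ u, (p.coeff u).totalDegree ≤ k

namespace CoeffDegreeLE

variable {σ τ : Type*} {k l : ℕ} {p q : MvPolynomial σ (MvPolynomial τ ℂ)}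

lemma add (hp : CoeffDegreeLE k p) (hq : CoeffDegreeLE k q) : CoeffDegreeLE k (p + q) := fun u => by
  rw [coeff_add]
  exact (totalDegree_add _ _).trans (max_le (hp u) (hq u))

lemma sub (hp : CoeffDegreeLE k p) (hq : CoeffDegreeLE k q) : CoeffDegreeLE k (p - q) := fun u => by
  rw [coeff_sub]
  exact (totalDegree_sub _ _).trans (max_le (hp u) (hq u))

lemma mul (hp : CoeffDegreeLE k p) (hq : CoeffDegreeLE l q) : CoeffDegreeLE (k + l) (p * q) :=
  fun u => by
    classical
    rw [coeff_mul]
    exact totalDegree_finsetSum_le fun x _ =>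
      (totalDegree_mul _ _).trans (add_le_add (hp _) (hq _))

lemma mono (hp : CoeffDegreeLE k p) (h : k ≤ l) : CoeffDegreeLE l p := fun u => (hp u).trans h

lemma map_C (p : MvPolynomial σ ℂ) : CoeffDegreeLE (τ := τ) 0 (map C p) := fun u => by
  rw [coeff_map, totalDegree_C]

lemma sum_monomial_X {α : Type*} (s : Finset α) (f : α → σ →₀ ℕ) (g : α → τ) :
    CoeffDegreeLE 1 (∑ e ∈ s, monomial (f e) (X (g e) : MvPolynomial τ ℂ)) := fun u => by
  classical
  rw [coeff_sum]
  refine totalDegree_finsetSum_le fun e _ => ?_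
  rw [coeff_monomial]
  split_ifs <;> simp

end CoeffDegreeLE

lemma totalDegree_le_of_mem_system (F : MvPolynomial (Fin 4) ℂ) :
    ∀ p ∈ system d N F, p.totalDegree ≤ 2 := by
  classical
  have h₅ : ∀ k, CoeffDegreeLE 1 (generic₅ d N k) := fun k => .sum_monomial_X _ _ _
  have hXY : CoeffDegreeLE 1 (inXY (generic₂ d N 0)) := by
    simp only [inXY, generic₂, map_sum, rename_monomial]
    exact .sum_monomial_X _ _ _
  have hZT : CoeffDegreeLE 1 (inZT (generic₂ d N 1)) := by
    simp only [inZT, generic₂, map_sum, rename_monomial]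
    exact .sum_monomial_X _ _ _
  -- The coefficients of `F` are constants, so the term with `q` is linear in the unknowns and only
  -- the other two products are quadratic.
  have hrab : CoeffDegreeLE (τ := Unknown d N) 0 (rab (map C F)) := by
    rw [← map_rab]
    exact .map_C _
  have hone : CoeffDegreeLE (τ := Unknown d N) 0 (1 : MvPolynomial (Fin 5) _) := by
    simpa using CoeffDegreeLE.map_C (τ := Unknown d N) (1 : MvPolynomial (Fin 5) ℂ)
  have hid : CoeffDegreeLE 2 (genericIdentity d N F) :=
    (((((h₅ 0).mul hrab).mono (by omega)).add ((h₅ 1).mul hXY)).add ((h₅ 2).mul hZT)).sub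
      (hone.mono (by omega))
  have hnon : ∀ k l, (nonconstEq d N k l).totalDegree ≤ 2 := fun k l => by
    refine (totalDegree_sub _ _).trans (max_le (totalDegree_finsetSum_le fun e _ => ?_) (by simp))
    exact (totalDegree_mul _ _).trans (by simp)
  intro p hp
  simp only [system, Finset.mem_union, Finset.mem_insert, Finset.mem_singleton] at hp
  rcases hp with hp | rfl | rfl
  · obtain ⟨u, -, rfl⟩ := mem_coeffs_iff.mp hp
    exact hid u
  · exact hnon _ _
  · exact hnon _ _

end System

end CartesianPoly

theorem theorem1p9 :
    -- characterization by certificates of bounded degree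
    (∀ (d : ℕ) (F : MvPolynomial (Fin 4) ℂ), F ≠ 0 → F.totalDegree = d →
      (CartesianPoly.IsCartesian F ↔
        ∃ (G H : MvPolynomial (Fin 2) ℂ) (q q₁ q₂ : MvPolynomial (Fin 5) ℂ),
          CartesianPoly.IsCertificate d (CartesianPoly.bound d) F G H q q₁ q₂) ∧
      (d = 2 → CartesianPoly.IsCartesian F →
        ∃ (G H : MvPolynomial (Fin 2) ℂ) (q q₁ q₂ : MvPolynomial (Fin 5) ℂ),
          CartesianPoly.IsCertificate d 24 F G H q q₁ q₂)) ∧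
    -- reduction to an explicit finite system of equations of degree at most 2,
    -- whose solvability is read off from any Gröbner basis
    (∀ (d : ℕ) (F : MvPolynomial (Fin 4) ℂ), F ≠ 0 → F.totalDegree = d →
      (∀ p ∈ CartesianPoly.system d (CartesianPoly.bound d) F, p.totalDegree ≤ 2) ∧
      (CartesianPoly.IsCartesian F ↔
        ∃ a : CartesianPoly.Unknown d (CartesianPoly.bound d) → ℂ,
          ∀ p ∈ CartesianPoly.system d (CartesianPoly.bound d) F, MvPolynomial.eval a p = 0) ∧
      (∀ m : MonomialOrder.{0, 0} (CartesianPoly.Unknown d (CartesianPoly.bound d)),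
        (∃ B, CartesianPoly.IsGroebnerBasis m
          (Ideal.span (CartesianPoly.system d (CartesianPoly.bound d) F : Set _)) B) ∧
        ∀ B, CartesianPoly.IsGroebnerBasis m
            (Ideal.span (CartesianPoly.system d (CartesianPoly.bound d) F : Set _)) B →
          (CartesianPoly.IsCartesian F ↔ ¬ ∃ c : ℂ, c ≠ 0 ∧ MvPolynomial.C c ∈ B))) ∧
    -- decidability: an algorithm produces from the degree a finite list of zero tests on
    -- integer polynomials in the coefficients that decides whether a polynomial is Cartesian
    (∃ decide : ℕ → CartesianPoly.ZeroTests, Computable decide ∧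
      ∀ (d : ℕ) (F : MvPolynomial (Fin 4) ℂ), F.totalDegree ≤ d →
        (CartesianPoly.IsCartesian F ↔ CartesianPoly.ZeroTests.Accepts (decide d) F)) := by
  refine ⟨fun d F hF0 hd => ?_, fun d F hF0 hd => ?_, CartesianPoly.cartesianTests,
    CartesianPoly.primrec_cartesianTests.to_comp, fun d F hd =>
      CartesianPoly.isCartesian_iff_accepts hd⟩
  · subst hd
    refine ⟨⟨fun hF => hF.exists_isCertificate hF0 (CartesianPoly.succ_le_bound _), ?_⟩,
      -- For degree 2 the construction only needs degree 3, which is at most 24.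
      fun h2 hF => hF.exists_isCertificate hF0 (by omega)⟩
    rintro ⟨G, H, q, q₁, q₂, h⟩
    exact h.isCartesian
  · subst hd
    have hsol := CartesianPoly.isCartesian_iff_exists_solution hF0
      (CartesianPoly.succ_le_bound F.totalDegree)
    refine ⟨CartesianPoly.totalDegree_le_of_mem_system F, hsol, fun m =>
      ⟨CartesianPoly.exists_isGroebnerBasis m _, fun B hB => ?_⟩⟩
    rw [← hB.eq_top_iff, ← Ne, MvPolynomial.span_ne_top_iff_exists_eval_eq_zero]
    exact hsol
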